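/- Let $n\ge 2$, let $\mathcal I\subseteq(0,\infty)$ be an open interval, let $f\colon\mathcal I\to(0,\infty)$ be smooth, and consider the class-$\mathcal S$ spacetime $\mathbb R\times M^n$, $M^n=\mathcal I\times\mathbb S^{n-1}\ni(r,\xi)$, with the metric $$\mathfrak g=-f(r)\,dt^2+\frac1{f(r)}\,dr^2+r^2\,\Omega ,$$ where $\Omega$ is the round metric of the unit sphere. Let $$\mathcal N=\{\omega\in T^*(\mathbb R\times M^n) : \omega\neq0,\ \mathfrak g(\omega^\#,\omega^\#)=0\}$$ be the null section of its phase space. Definitions. * Null geodesics are affinely parametrized, have nowhere vanishing velocity, and are defined on open intervals; such a geodesic is maximal if it cannot be extended to a larger interval. * A *photon surface* is an embedded timelike hypersurface $P$ that is null totally geodesic: a null geodesic tangent to $P$ at some parameter stays in $P$, and tangent to $P$, for all nearby parameters. * A connected photon surface $P$ is *spherically symmetric* if each nonempty $P\cap\{t=t_0\}$ equals $\{t_0\}\times\{r_0\}\times\mathbb S^{n-1}$ for some $r_0\in\mathcal I$. It is *maximal* if it is not contained in a strictly larger connected, spherically symmetric photon surface. * The *total angular momentum* of a null geodesic $\zeta=(t,r,\xi)$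 is $\ell=r^2|\dot\xi|_\Omega$ (a constant along $\zeta$). A *maximal principal null hypersurface* is a set $H_\zeta=\{(t(s),r(s),\xi_*) : s\in J,\ \xi_*\in\mathbb S^{n-1}\}$ for a maximal null geodesic $\zeta=(t,r,\xi)\colon J\to\mathbb R\times M^n$ with $\ell=0$. * For a surface $S$ of either kind, the *canonical lift* of its null bundle is $\mathcal N(S)=\{\omega\in\mathcal N : \omega \text{ lies over a point } x\in S \text{ and } \omega^\#\in T_xS\}$. Proposition 3.6. $\mathcal N$ is foliated by the lifts $\mathcal N(P)$ of all maximal spherically symmetric photon surfaces $P$ together with the lifts $\mathcal N(H)$ of all maximal principal null hypersurfaces $H$, in the following sense. Each $\mathcal N(P)$ is a nonempty embedded smooth submanifold of $T^*(\mathbb R\times M^n)$ of dimension $2n-1$, and each $\mathcal N(H)$ is one of dimension $n+1$. No set is both a maximal spherically symmetric photon surface and a maximal principal null hypersurface; the lifts of any two different surfaces from the two families are disjoint; and the union of all the lifts is $\mathcal N$. -/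

import Mathlib

open Set Filter Topology
open scoped ContDiff

noncomputable section

/-- `S` is an embedded smooth submanifold of dimension `d` of the finite-dimensional space `V`:
near each of its points it is the zero set of a smooth submersion to `ℝ^k`, with
`d + k = dim V`. -/
def IsEmbeddedSubmanifold {V : Type*} [NormedAddCommGroup V] [NormedSpace ℝ V]
    (d : ℕ) (S : Set V) : Prop :=
  ∃ k : ℕ, d + k = Module.finrank ℝ V ∧
    ∀ x ∈ S, ∃ U : Set V, IsOpen U ∧ x ∈ U ∧ ∃ φ : V → (Fin k → ℝ),
      ContDiffOn ℝ ∞ φ U ∧ (∀ y ∈ U, Function.Surjective (fderiv ℝ φ y)) ∧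
      S ∩ U = {y | y ∈ U ∧ φ y = 0}

/-- The vectors tangent to `S` at `x`: velocities at `x` of curves in `S`. For an embedded
submanifold this is the usual tangent space. -/
def tangentVectors {V : Type*} [NormedAddCommGroup V] [NormedSpace ℝ V]
    (S : Set V) (x : V) : Set V :=
  {v | ∃ γ : ℝ → V, γ 0 = x ∧ (∀ᶠ s in 𝓝 (0 : ℝ), γ s ∈ S) ∧ HasDerivAt γ v 0}

/-- The vector space `ℝ × ℝⁿ` of pairs `(t, y)`. -/
abbrev Event (n : ℕ) : Type := ℝ × EuclideanSpace ℝ (Fin n)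

/-- The space of covectors at an event. -/
abbrev Covector (n : ℕ) : Type := Event n →L[ℝ] ℝ

/-- The data of a spacetime of class `𝒮`: an open interval `𝓘 ⊆ (0, ∞)` of radii and a smooth
positive function `f` on it. The spacetime is `ℝ × 𝓘 × 𝕊ⁿ⁻¹` with the metric
`-f(r) dt² + f(r)⁻¹ dr² + r² Ω`.

Throughout, `(r, ξ) ∈ 𝓘 × 𝕊ⁿ⁻¹` is identified with the point `y = r ξ` of the spherical shell
`{y ∈ ℝⁿ | ‖y‖ ∈ 𝓘}` (polar coordinates are a diffeomorphism), so that the spacetime becomes an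
open subset of `ℝ × ℝⁿ` and its cotangent bundle is trivialized. -/
structure ClassS (n : ℕ) where
  /-- the interval `𝓘` of radii -/
  radii : Set ℝ
  isOpen_radii : IsOpen radii
  ordConnected_radii : radii.OrdConnected
  radii_pos : radii ⊆ Ioi 0
  /-- the metric coefficient -/
  f : ℝ → ℝ
  contDiffOn_f : ContDiffOn ℝ ∞ f radii
  f_pos : ∀ r ∈ radii, 0 < f r

namespace ClassS

variable {n : ℕ}

/-- The spacetime manifold `ℝ × 𝓘 × 𝕊ⁿ⁻¹`, as the set of `(t, y)` with `‖y‖ ∈ 𝓘`. -/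
def carrier (X : ClassS n) : Set (Event n) := {x | ‖x.2‖ ∈ X.radii}

/-- The differential `dr` of the radius `r(t, y) = ‖y‖` at `x`, applied to `u`. -/
def dr (x u : Event n) : ℝ := inner ℝ x.2 u.2 / ‖x.2‖

/-- The metric `-f dt² + f⁻¹ dr² + r² Ω` at `x`, where `r² Ω = |dy|² - dr²`. -/
def metric (X : ClassS n) (x u v : Event n) : ℝ :=
  -X.f ‖x.2‖ * (u.1 * v.1) + (X.f ‖x.2‖)⁻¹ * (dr x u * dr x v)
    + (inner ℝ u.2 v.2 - dr x u * dr x v)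

/-- The metric in polar coordinates: the tangent vector with components
`(τ, ρ, η) ∈ ℝ × ℝ × T_ξ 𝕊ⁿ⁻¹` at `(t, r, ξ)` is `(τ, ρ ξ + r η)` at `(t, r ξ)`. -/
theorem metric_polar (X : ClassS n) {t r τ τ' ρ ρ' : ℝ} {ξ η η' : EuclideanSpace ℝ (Fin n)}
    (hr : 0 < r) (hξ : ‖ξ‖ = 1) (hη : inner ℝ ξ η = 0) (hη' : inner ℝ ξ η' = 0) :
    X.metric (t, r • ξ) (τ, ρ • ξ + r • η) (τ', ρ' • ξ + r • η') =
      -X.f r * (τ * τ') + (X.f r)⁻¹ * (ρ * ρ') + r ^ 2 * inner ℝ η η' := by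
  have h1 : ‖r • ξ‖ = r := by rw [norm_smul, hξ, Real.norm_of_nonneg hr.le, mul_one]
  have h2 : inner ℝ ξ ξ = (1 : ℝ) := by rw [real_inner_self_eq_norm_sq, hξ]; norm_num
  have h3 : inner ℝ η ξ = (0 : ℝ) := by rw [real_inner_comm, hη]
  have h4 : r ≠ 0 := hr.ne'
  simp only [metric, dr, h1, inner_add_left, inner_add_right, real_inner_smul_left,
    real_inner_smul_right, h2, hη, hη', h3]
  field_simp
  ring

/-- The vector `α♯` at `x` which is metrically dual to the covector `α`. -/
def sharp (X : ClassS n) (x : Event n) (α : Covector n) : Event n :=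
  let b := (InnerProductSpace.toDual ℝ (EuclideanSpace ℝ (Fin n))).symm
    (α.comp (ContinuousLinearMap.inr ℝ ℝ (EuclideanSpace ℝ (Fin n))))
  (-(X.f ‖x.2‖)⁻¹ * α (1, 0), b + ((X.f ‖x.2‖ - 1) * inner ℝ x.2 b / ‖x.2‖ ^ 2) • x.2)

/-- The defining property of `α♯`. -/
theorem metric_sharp (X : ClassS n) {x : Event n} (hx : x ∈ X.carrier) (α : Covector n)
    (v : Event n) : X.metric x (X.sharp x α) v = α v := by
  have hr : ‖x.2‖ ≠ 0 := (X.radii_pos hx).ne'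
  have hf : X.f ‖x.2‖ ≠ 0 := (X.f_pos _ hx).ne'
  have hv : α v = v.1 * α (1, 0) + α (0, v.2) := by
    have h : v = v.1 • ((1, 0) : Event n) + (0, v.2) := by
      ext <;> simp
    conv_lhs => rw [h]
    rw [map_add, map_smul, smul_eq_mul]
  set b := (InnerProductSpace.toDual ℝ (EuclideanSpace ℝ (Fin n))).symm
    (α.comp (ContinuousLinearMap.inr ℝ ℝ (EuclideanSpace ℝ (Fin n)))) with hb
  have hbv : inner ℝ b v.2 = α (0, v.2) := by
    rw [hb, InnerProductSpace.toDual_symm_apply]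
    simp
  have hxx : inner ℝ x.2 x.2 = ‖x.2‖ ^ 2 := real_inner_self_eq_norm_sq _
  rw [hv, ← hbv]
  simp only [metric, dr, sharp, ← hb, inner_add_left, inner_add_right, real_inner_smul_left,
    real_inner_smul_right, hxx]
  field_simp
  ring

/-- `ζ`, defined on the open interval `J`, is an (affinely parametrized) null geodesic. The last
clause says `𝔤(∇_ζ' ζ', v) = 0` for all `v`, with the Levi-Civita connection in coordinates:
`𝔤(∇_u u, v) = 𝔤(u', v) + (∂_u 𝔤)(u, v) - (∂_v 𝔤)(u, u) / 2` for `u = ζ'`. (A solution of class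
`C²` of this equation is automatically smooth.) -/
structure IsNullGeodesic (X : ClassS n) (ζ : ℝ → Event n) (J : Set ℝ) : Prop where
  isOpen : IsOpen J
  ordConnected : J.OrdConnected
  nonempty : J.Nonempty
  mapsTo : MapsTo ζ J X.carrier
  contDiffOn : ContDiffOn ℝ 2 ζ J
  velocity_ne_zero : ∀ s ∈ J, deriv ζ s ≠ 0
  null : ∀ s ∈ J, X.metric (ζ s) (deriv ζ s) (deriv ζ s) = 0
  geodesic : ∀ s ∈ J, ∀ v : Event n,
    X.metric (ζ s) (deriv (deriv ζ) s) v
      + fderiv ℝ (fun x => X.metric x (deriv ζ s) v) (ζ s) (deriv ζ s)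
      - fderiv ℝ (fun x => X.metric x (deriv ζ s) (deriv ζ s)) (ζ s) v / 2 = 0

/-- A null geodesic which cannot be extended to a larger interval. -/
def IsMaximalNullGeodesic (X : ClassS n) (ζ : ℝ → Event n) (J : Set ℝ) : Prop :=
  X.IsNullGeodesic ζ J ∧
    ∀ ζ' J', X.IsNullGeodesic ζ' J' → J ⊆ J' → EqOn ζ ζ' J → J' = J

/-- The rotational Killing vector field `y_i ∂_j - y_j ∂_i`. -/
def rotationField (i j : Fin n) (x : Event n) : Event n :=
  (0, x.2 i • EuclideanSpace.single j (1 : ℝ) - x.2 j • EuclideanSpace.single i (1 : ℝ))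

/-- The total angular momentum `ℓ` of the velocity `v` at `x`. It is `(Ω^{KL} ℓ_K ℓ_L)^{1/2}` with
`ℓ_K = 𝔤(X_K, v)`, because `½ ∑ X_ij ⊗ X_ij`, over the rotation fields, is the inverse of the
round metric `Ω`. -/
def angularMomentum (X : ClassS n) (x v : Event n) : ℝ :=
  √(1 / 2 * ∑ i, ∑ j, X.metric x (rotationField i j x) v ^ 2)

/-- The set `H_ζ` generated by a curve `ζ` on `J` under rotations. -/
def generated (ζ : ℝ → Event n) (J : Set ℝ) : Set (Event n) :=
  {x | ∃ s ∈ J, x.1 = (ζ s).1 ∧ ‖x.2‖ = ‖(ζ s).2‖}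

/-- Embedded timelike hypersurfaces of the spacetime. (A hyperplane of a Lorentzian vector space
inherits a Lorentzian metric if and only if it contains a timelike vector.) -/
def IsTimelikeHypersurface (X : ClassS n) (P : Set (Event n)) : Prop :=
  P ⊆ X.carrier ∧ IsEmbeddedSubmanifold n P ∧
    ∀ x ∈ P, ∃ v ∈ tangentVectors P x, X.metric x v v < 0

/-- Photon surfaces: timelike hypersurfaces `P` which are null totally geodesic, i.e. a null
geodesic that is tangent to `P` at some parameter remains in `P` and tangent to it for all nearby
parameters. -/
def IsPhotonSurface (X : ClassS n) (P : Set (Event n)) : Prop :=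
  X.IsTimelikeHypersurface P ∧
    ∀ ζ J, X.IsNullGeodesic ζ J → ∀ s₀ ∈ J, ζ s₀ ∈ P →
      deriv ζ s₀ ∈ tangentVectors P (ζ s₀) →
      ∀ᶠ s in 𝓝 s₀, ζ s ∈ P ∧ deriv ζ s ∈ tangentVectors P (ζ s)

/-- Every nonempty time-slice of `P` is a centered round sphere with radius in `𝓘`. -/
def IsSphericallySymmetric (X : ClassS n) (P : Set (Event n)) : Prop :=
  ∀ t₀ : ℝ, (P ∩ {x | x.1 = t₀}).Nonempty →
    ∃ r₀ ∈ X.radii, P ∩ {x | x.1 = t₀} = {x | x.1 = t₀ ∧ ‖x.2‖ = r₀}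

/-- Connected, spherically symmetric photon surfaces. -/
def IsSphericalPhotonSurface (X : ClassS n) (P : Set (Event n)) : Prop :=
  X.IsPhotonSurface P ∧ IsConnected P ∧ X.IsSphericallySymmetric P

/-- The maximal ones: those not contained in a strictly larger one. -/
def IsMaximalSphericalPhotonSurface (X : ClassS n) (P : Set (Event n)) : Prop :=
  X.IsSphericalPhotonSurface P ∧ ∀ Q, X.IsSphericalPhotonSurface Q → P ⊆ Q → Q = P

/-- Maximal principal null hypersurfaces: those generated by a maximal null geodesic of zero
angular momentum. -/
def IsMaximalPrincipalNullHypersurface (X : ClassS n) (H : Set (Event n)) : Prop :=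
  ∃ ζ J, X.IsMaximalNullGeodesic ζ J ∧
    (∀ s ∈ J, X.angularMomentum (ζ s) (deriv ζ s) = 0) ∧ H = generated ζ J

/-- The null section `𝒩` of phase space: the nonzero covectors `α` with `𝔤(α♯, α♯) = 0`. -/
def nullSection (X : ClassS n) : Set (Event n × Covector n) :=
  {p | p.1 ∈ X.carrier ∧ p.2 ≠ 0 ∧ X.metric p.1 (X.sharp p.1 p.2) (X.sharp p.1 p.2) = 0}

/-- The canonical lift `𝒩(S)` of the null bundle over `S`: the null covectors `α` over points of
`S` such that `α♯` is tangent to `S`. -/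
def nullLift (X : ClassS n) (S : Set (Event n)) : Set (Event n × Covector n) :=
  {p | p ∈ X.nullSection ∧ p.1 ∈ S ∧ X.sharp p.1 p.2 ∈ tangentVectors S p.1}

end ClassS

end

/-! Along a null geodesic put `q = dr/dt`. Nullity expresses the squared angular speed through `r`,
`dr/ds` and `dt/ds`. Once it is eliminated, the angular momentum disappears and `(r, q)` obeys the
autonomous system `dr/dt = q`, `dq/dt = force r q` (`IsNullGeodesic.hasDerivAt_flow`). Being tangent
to a hypersurface `r = R(t)` means `q = R'(t)`. Uniqueness for this system therefore makes the graph
of every solution with `|R'| < f(R)` a photon surface. Conversely, a spherically symmetric timelike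
hypersurface is such a graph by the implicit function theorem, and following one tangent null
geodesic through each of its time slices shows that `R` solves the equation
(`IsSphericalPhotonSurface.exists_isProfile`). Maximal spherical photon surfaces are thus the
maximal timelike solutions, and each is determined by its data `(t, r, q)` at one instant.

A null covector determines such data, and the nonnegativity of the angular term in the metric gives
`|q| ≤ f`. If the inequality is strict, exactly one maximal solution has these data. If equality
holds, the vector is radial and belongs to the null cone `t = c ± F(r)` with `F' = 1/f`; these cones
are precisely the maximal principal null hypersurfaces
(`IsMaximalPrincipalNullHypersurface.exists_eq_nullCone`). Covering and disjointness follow from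
this dichotomy and from uniqueness.

For the submanifold claims, let `y` be the position, `a` the time component and `b` the spatial part
of the covector. The lift of a photon surface is given by three independent equations for `|y|²`,
`⟨y, b⟩` and `|b|²`; the lift of a null cone is given by `n + 1` equations solved for `t` and `b`.
The ambient dimension is `2n + 2`. -/

/-! ### Derivatives along curves -/

theorem hasDerivAt_norm_curve {E : Type*} [NormedAddCommGroup E] [InnerProductSpace ℝ E]
    {y : ℝ → E} {w : E} {s : ℝ} (h : HasDerivAt y w s) (h0 : y s ≠ 0) :
    HasDerivAt (fun s => ‖y s‖) (inner ℝ (y s) w / ‖y s‖) s := by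
  have h1 : HasDerivAt (fun s => √(‖y s‖ ^ 2)) (2 * inner ℝ (y s) w / (2 * √(‖y s‖ ^ 2))) s :=
    h.norm_sq.sqrt (by simpa using h0)
  simp only [Real.sqrt_sq (norm_nonneg _)] at h1
  convert h1 using 1
  field_simp

theorem hasDerivAt_fst_curve {E F : Type*} [NormedAddCommGroup E] [NormedSpace ℝ E]
    [NormedAddCommGroup F] [NormedSpace ℝ F] {x : ℝ → E × F} {v : E × F} {s : ℝ}
    (h : HasDerivAt x v s) : HasDerivAt (fun s => (x s).1) v.1 s :=
  (hasFDerivAt_fst (𝕜 := ℝ) (p := x s)).comp_hasDerivAt s h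

theorem hasDerivAt_snd_curve {E F : Type*} [NormedAddCommGroup E] [NormedSpace ℝ E]
    [NormedAddCommGroup F] [NormedSpace ℝ F] {x : ℝ → E × F} {v : E × F} {s : ℝ}
    (h : HasDerivAt x v s) : HasDerivAt (fun s => (x s).2) v.2 s :=
  (hasFDerivAt_snd (𝕜 := ℝ) (p := x s)).comp_hasDerivAt s h

/-! ### The geodesic equation in Cartesian coordinates -/

namespace ClassS

variable {n : ℕ} (X : ClassS n)

theorem norm_pos {x : Event n} (hx : x ∈ X.carrier) : 0 < ‖x.2‖ := X.radii_pos hx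

theorem snd_ne_zero {x : Event n} (hx : x ∈ X.carrier) : x.2 ≠ 0 := norm_pos_iff.1 (X.norm_pos hx)

theorem isOpen_carrier : IsOpen X.carrier :=
  X.isOpen_radii.preimage (continuous_norm.comp continuous_snd)

theorem metric_eq (x u v : Event n) :
    X.metric x u v = -X.f ‖x.2‖ * (u.1 * v.1) + inner ℝ u.2 v.2
      + ((X.f ‖x.2‖)⁻¹ - 1) / ‖x.2‖ ^ 2 * (inner ℝ x.2 u.2 * inner ℝ x.2 v.2) := by
  simp only [metric, dr]
  ring

theorem metric_self (x v : Event n) :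
    X.metric x v v = -X.f ‖x.2‖ * v.1 ^ 2 + (X.f ‖x.2‖)⁻¹ * dr x v ^ 2
      + (‖v.2‖ ^ 2 - dr x v ^ 2) := by
  simp only [metric, real_inner_self_eq_norm_sq]
  ring

theorem hasDerivAt_f {r : ℝ} (hr : r ∈ X.radii) : HasDerivAt X.f (deriv X.f r) r :=
  ((X.contDiffOn_f.contDiffAt (X.isOpen_radii.mem_nhds hr)).differentiableAt
    (by simp)).hasDerivAt

/-- The derivative of the metric coefficients at `x` in the direction `h`, applied to `u`, `v`. -/
noncomputable def metricDeriv (x h u v : Event n) : ℝ :=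
  -(deriv X.f ‖x.2‖ * (inner ℝ x.2 h.2 / ‖x.2‖)) * (u.1 * v.1)
  + (-(deriv X.f ‖x.2‖ / X.f ‖x.2‖ ^ 2) / ‖x.2‖ ^ 2 - 2 * ((X.f ‖x.2‖)⁻¹ - 1) / ‖x.2‖ ^ 3)
      * (inner ℝ x.2 h.2 / ‖x.2‖) * (inner ℝ x.2 u.2 * inner ℝ x.2 v.2)
  + ((X.f ‖x.2‖)⁻¹ - 1) / ‖x.2‖ ^ 2 *
      (inner ℝ h.2 u.2 * inner ℝ x.2 v.2 + inner ℝ x.2 u.2 * inner ℝ h.2 v.2)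

theorem hasDerivAt_metric {x u v : ℝ → Event n} {x' u' v' : Event n} {s : ℝ}
    (hx : HasDerivAt x x' s) (hu : HasDerivAt u u' s) (hv : HasDerivAt v v' s)
    (hs : x s ∈ X.carrier) :
    HasDerivAt (fun s => X.metric (x s) (u s) (v s))
      (X.metric (x s) u' (v s) + X.metric (x s) (u s) v' + X.metricDeriv (x s) x' (u s) (v s))
      s := by
  have hx2 := hasDerivAt_snd_curve hx
  have hu2 := hasDerivAt_snd_curve hu
  have hv2 := hasDerivAt_snd_curve hv
  have hr0 := X.norm_pos hs
  have hf0 := X.f_pos _ hs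
  have hr := hasDerivAt_norm_curve hx2 (X.snd_ne_zero hs)
  have hf := (X.hasDerivAt_f hs).comp s hr
  have hB := ((hf.fun_inv hf0.ne').sub_const 1).fun_div (hr.fun_pow 2) (pow_ne_zero 2 hr0.ne')
  have h := ((hf.neg.mul ((hasDerivAt_fst_curve hu).mul (hasDerivAt_fst_curve hv))).add (hu2.inner ℝ hv2)).add
    (hB.mul ((hx2.inner ℝ hu2).mul (hx2.inner ℝ hv2)))
  simp only [metric_eq]
  refine HasDerivAt.congr_deriv h ?_
  simp only [metricDeriv, Pi.mul_apply, Pi.neg_apply, Function.comp]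
  field_simp
  ring

theorem differentiableAt_metric {x : Event n} (hx : x ∈ X.carrier) (u v : Event n) :
    DifferentiableAt ℝ (fun x => X.metric x u v) x := by
  have hr0 := X.norm_pos hx
  have hf0 := X.f_pos _ hx
  have hr : DifferentiableAt ℝ (fun x : Event n => ‖x.2‖) x :=
    differentiableAt_snd.norm ℝ (X.snd_ne_zero hx)
  have hf : DifferentiableAt ℝ (fun x : Event n => X.f ‖x.2‖) x :=
    (X.hasDerivAt_f hx).differentiableAt.comp x hr
  have hi : ∀ w, DifferentiableAt ℝ (fun x : Event n => inner ℝ x.2 w) x := fun w =>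
    differentiableAt_snd.inner ℝ (differentiableAt_const _)
  have hB : DifferentiableAt ℝ (fun x : Event n => ((X.f ‖x.2‖)⁻¹ - 1) / ‖x.2‖ ^ 2) x := by
    simp only [div_eq_mul_inv]
    exact ((hf.fun_inv hf0.ne').sub_const 1).fun_mul
      ((hr.fun_pow 2).fun_inv (pow_ne_zero 2 hr0.ne'))
  simp only [metric_eq]
  exact ((hf.neg.mul_const _).add (differentiableAt_const _)).add
    (hB.mul ((hi _).mul (hi _)))

theorem fderiv_metric {x : Event n} (hx : x ∈ X.carrier) (u v h : Event n) :
    fderiv ℝ (fun x => X.metric x u v) x h = X.metricDeriv x h u v := by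
  have hl : HasDerivAt (fun s : ℝ => x + s • h) h 0 := by
    simpa using ((hasDerivAt_id (0 : ℝ)).smul_const h).const_add x
  have h1 := X.hasDerivAt_metric hl (hasDerivAt_const 0 u) (hasDerivAt_const 0 v) (by simpa)
  have h2 : HasDerivAt (fun s : ℝ => X.metric (x + s • h) u v)
      (fderiv ℝ (fun x => X.metric x u v) x h) 0 := by
    have := (X.differentiableAt_metric (u := u) (v := v) (x := x + (0 : ℝ) • h)
      (by simpa)).hasFDerivAt.comp_hasDerivAt 0 hl
    simpa [Function.comp_def] using this
  rw [h2.unique h1]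
  simp [metric_eq]

/-- The acceleration of a geodesic at `x` with velocity `u`. -/
noncomputable def accel (x u : Event n) : Event n :=
  (-(deriv X.f ‖x.2‖ * inner ℝ x.2 u.2 * u.1 / (X.f ‖x.2‖ * ‖x.2‖)),
    -(X.f ‖x.2‖ * ((-(deriv X.f ‖x.2‖ / X.f ‖x.2‖ ^ 2) / ‖x.2‖ ^ 2
        - 2 * ((X.f ‖x.2‖)⁻¹ - 1) / ‖x.2‖ ^ 3) / ‖x.2‖ * inner ℝ x.2 u.2 ^ 2 / 2
      + ((X.f ‖x.2‖)⁻¹ - 1) / ‖x.2‖ ^ 2 * inner ℝ u.2 u.2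
      + deriv X.f ‖x.2‖ / ‖x.2‖ * u.1 ^ 2 / 2)) • x.2)

/-- `accel` is the geodesic equation solved for the second derivative, so the left side measures the
failure of `a` to equal it. Nondegeneracy of the metric then turns the weak form of the equation
into `a = accel`. -/
theorem geodesic_expr {x : Event n} (hx : x ∈ X.carrier) (u a v : Event n) :
    X.metric x a v + fderiv ℝ (fun x => X.metric x u v) x u
      - fderiv ℝ (fun x => X.metric x u u) x v / 2 = X.metric x (a - X.accel x u) v := by
  have hr0 := (X.norm_pos hx).ne'
  have hf0 := (X.f_pos _ hx).ne'
  rw [X.fderiv_metric hx, X.fderiv_metric hx]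
  have h1 : inner ℝ x.2 x.2 = ‖x.2‖ ^ 2 := real_inner_self_eq_norm_sq _
  have h2 : inner ℝ v.2 u.2 = (inner ℝ u.2 v.2 : ℝ) := real_inner_comm _ _
  simp only [metric_eq, metricDeriv, accel, Prod.fst_sub, Prod.snd_sub, inner_sub_left,
    inner_sub_right, inner_smul_left, inner_smul_right, h1, h2, conj_trivial]
  field_simp
  ring

theorem metric_nondegenerate {x : Event n} (hx : x ∈ X.carrier) {u : Event n}
    (h : ∀ v, X.metric x u v = 0) : u = 0 := by
  have hr0 := (X.norm_pos hx).ne'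
  have hf0 := (X.f_pos _ hx).ne'
  have h1 := h (1, 0)
  have h2 := h (0, x.2)
  simp [metric_eq, hf0] at h1
  simp only [metric_eq, real_inner_self_eq_norm_sq, mul_zero, zero_add,
    real_inner_comm x.2 u.2] at h2
  have h3 : inner ℝ x.2 u.2 = (0 : ℝ) := by
    field_simp at h2
    linear_combination h2
  have h4 := h (0, u.2)
  simp only [metric_eq, h3] at h4
  simp at h4
  exact Prod.ext h1 h4

theorem geodesic_iff {x : Event n} (hx : x ∈ X.carrier) (u a : Event n) :
    (∀ v, X.metric x a v + fderiv ℝ (fun x => X.metric x u v) x u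
      - fderiv ℝ (fun x => X.metric x u u) x v / 2 = 0) ↔ a = X.accel x u := by
  simp only [X.geodesic_expr hx]
  refine ⟨fun h => sub_eq_zero.1 (X.metric_nondegenerate hx h), fun h v => ?_⟩
  simp [h, metric_eq]

/-- The left side is the derivative of `𝔤(ζ', ζ')` along a geodesic. It vanishes by testing the
geodesic equation against the velocity itself, so nullity at one parameter persists. -/
theorem metricDeriv_self {x : Event n} (hx : x ∈ X.carrier) (u : Event n) :
    X.metric x (X.accel x u) u + X.metric x u (X.accel x u) + X.metricDeriv x u u u = 0 := by
  have h := (X.geodesic_iff hx u (X.accel x u)).2 rfl u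
  rw [X.fderiv_metric hx] at h
  have h2 : X.metric x u (X.accel x u) = X.metric x (X.accel x u) u := by
    simp only [metric, real_inner_comm]
    ring
  rw [h2]
  linear_combination 2 * h

variable {X}

theorem IsNullGeodesic.hasDerivAt {ζ : ℝ → Event n} {J : Set ℝ} (h : X.IsNullGeodesic ζ J)
    {s : ℝ} (hs : s ∈ J) : HasDerivAt ζ (deriv ζ s) s :=
  ((h.contDiffOn.contDiffAt (h.isOpen.mem_nhds hs)).differentiableAt (by simp)).hasDerivAt

theorem IsNullGeodesic.hasDerivAt_deriv {ζ : ℝ → Event n} {J : Set ℝ}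
    (h : X.IsNullGeodesic ζ J) {s : ℝ} (hs : s ∈ J) :
    HasDerivAt (deriv ζ) (X.accel (ζ s) (deriv ζ s)) s := by
  have h1 : ContDiffOn ℝ 1 (deriv ζ) J := h.contDiffOn.deriv_of_isOpen h.isOpen (by norm_num)
  have h2 := ((h1.contDiffAt (h.isOpen.mem_nhds hs)).differentiableAt (by simp)).hasDerivAt
  rwa [(X.geodesic_iff (h.mapsTo hs) _ _).1 (h.geodesic s hs)] at h2

theorem contDiffAt_accel {p : Event n × Event n} (hp : p.1 ∈ X.carrier) :
    ContDiffAt ℝ 1 (fun p : Event n × Event n => X.accel p.1 p.2) p := by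
  have hr0 := (X.norm_pos hp).ne'
  have hf0 := (X.f_pos _ hp).ne'
  have hr : ContDiffAt ℝ 1 (fun p : Event n × Event n => ‖p.1.2‖) p :=
    (contDiffAt_fst.snd).norm ℝ (X.snd_ne_zero hp)
  have hf : ContDiffAt ℝ 1 (fun p : Event n × Event n => X.f ‖p.1.2‖) p :=
    ((X.contDiffOn_f.contDiffAt (X.isOpen_radii.mem_nhds hp)).of_le (by simp)).comp p hr
  have hf' : ContDiffAt ℝ 1 (fun p : Event n × Event n => deriv X.f ‖p.1.2‖) p :=
    ContDiffAt.comp (g := deriv X.f) p ((X.contDiffOn_f.deriv_of_isOpen (m := 1) X.isOpen_radii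
      (by norm_cast)).contDiffAt (X.isOpen_radii.mem_nhds hp)) hr
  have hy : ContDiffAt ℝ 1 (fun p : Event n × Event n => p.1.2) p := contDiffAt_fst.snd
  have hw : ContDiffAt ℝ 1 (fun p : Event n × Event n => p.2.2) p := contDiffAt_snd.snd
  have ht : ContDiffAt ℝ 1 (fun p : Event n × Event n => p.2.1) p := contDiffAt_snd.fst
  have hi : ContDiffAt ℝ 1 (fun p : Event n × Event n => (inner ℝ p.1.2 p.2.2 : ℝ)) p :=
    hy.inner ℝ hw
  have hiw : ContDiffAt ℝ 1 (fun p : Event n × Event n => (inner ℝ p.2.2 p.2.2 : ℝ)) p :=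
    hw.inner ℝ hw
  have hr2 := pow_ne_zero 2 hr0
  have hr3 := pow_ne_zero 3 hr0
  have hf2 := pow_ne_zero 2 hf0
  have hB := (hf.inv hf0).sub (contDiffAt_const (c := (1 : ℝ)))
  have hB' := (((hf'.div (hf.pow 2) hf2).neg).div (hr.pow 2) hr2).sub
    (((contDiffAt_const (c := (2 : ℝ))).mul hB).div (hr.pow 3) hr3)
  have h2 : ContDiffAt ℝ 1 (fun _ : Event n × Event n => (2 : ℝ)) p := contDiffAt_const
  exact (((hf'.mul hi).mul ht).div (hf.mul hr) (mul_ne_zero hf0 hr0)).neg.prodMk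
    ((hf.mul (((((hB'.div hr hr0).mul (hi.pow 2)).div h2 two_ne_zero).add
      ((hB.div (hr.pow 2) hr2).mul hiw)).add
      (((hf'.div hr hr0).mul (ht.pow 2)).div h2 two_ne_zero))).neg.smul hy)

end ClassS

/-! ### Reduction of null geodesics to a system for `r` and `dr/dt` -/

namespace ClassS

variable {n : ℕ} (X : ClassS n)

theorem dr_sq_le (x v : Event n) : dr x v ^ 2 ≤ ‖v.2‖ ^ 2 := by
  rw [dr, sq_le_sq, abs_div, abs_norm, abs_norm]
  rcases eq_or_ne ‖x.2‖ 0 with h | h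
  · simp [h]
  · rw [div_le_iff₀ (lt_of_le_of_ne (norm_nonneg _) h.symm), mul_comm]
    exact abs_real_inner_le_norm _ _

variable {X}

/-- The metric is positive definite on vectors without time component. Hence `t` is a regular
parameter along every null geodesic and `dr/dt` makes sense. -/
theorem fst_ne_zero_of_null {x v : Event n} (hx : x ∈ X.carrier) (hv : v ≠ 0)
    (h : X.metric x v v = 0) : v.1 ≠ 0 := by
  intro h1
  have hf := X.f_pos _ hx
  rw [metric_self, h1] at h
  have h2 := dr_sq_le x v
  have h3 : (X.f ‖x.2‖)⁻¹ * dr x v ^ 2 = 0 := by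
    have : 0 ≤ (X.f ‖x.2‖)⁻¹ * dr x v ^ 2 := by positivity
    linarith
  have h4 : dr x v ^ 2 = 0 := by simpa [hf.ne'] using h3
  rw [h3, h4] at h
  have h5 : v.2 = 0 := by simpa using h
  exact hv (Prod.ext h1 h5)

variable (X)

/-- The second derivative `d²r/dt²` along a null geodesic, in terms of `r` and `q = dr/dt`. -/
noncomputable def force (r q : ℝ) : ℝ :=
  -(X.f r * deriv X.f r / 2) + X.f r ^ 2 / r + q ^ 2 * (3 * deriv X.f r / (2 * X.f r) - 1 / r)

/-- The first-order system for `(r, dr/dt)` along a null geodesic. -/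
noncomputable def flow (z : ℝ × ℝ) : ℝ × ℝ := (z.2, X.force z.1 z.2)

theorem contDiffAt_flow {z : ℝ × ℝ} (hz : z.1 ∈ X.radii) : ContDiffAt ℝ ∞ X.flow z := by
  have hr0 : z.1 ≠ 0 := (X.radii_pos hz).ne'
  have hf0 := (X.f_pos _ hz).ne'
  have hr : ContDiffAt ℝ ∞ (fun z : ℝ × ℝ => z.1) z := contDiffAt_fst
  have hq : ContDiffAt ℝ ∞ (fun z : ℝ × ℝ => z.2) z := contDiffAt_snd
  have hf : ContDiffAt ℝ ∞ (fun z : ℝ × ℝ => X.f z.1) z :=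
    ContDiffAt.comp (g := X.f) z (X.contDiffOn_f.contDiffAt (X.isOpen_radii.mem_nhds hz)) hr
  have hf' : ContDiffAt ℝ ∞ (fun z : ℝ × ℝ => deriv X.f z.1) z :=
    ContDiffAt.comp (g := deriv X.f) z ((X.contDiffOn_f.deriv_of_isOpen (m := ∞) X.isOpen_radii
      (by simp)).contDiffAt (X.isOpen_radii.mem_nhds hz)) hr
  have hc : ∀ c : ℝ, ContDiffAt ℝ ∞ (fun _ : ℝ × ℝ => c) z := fun c => contDiffAt_const
  exact hq.prodMk (((hf.mul hf').div (hc 2) two_ne_zero).neg.add ((hf.pow 2).div hr hr0) |>.add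
    ((hq.pow 2).mul ((((hc 3).mul hf').div ((hc 2).mul hf) (mul_ne_zero two_ne_zero hf0)).sub
      ((hc 1).div hr hr0))))

/-- The factor `τ` stands for `dt/ds`: it allows solutions in the time `t` to be compared along the
affine parameter `s` of a geodesic. Near `s₀` it is bounded by `|τ s₀| + 1`, which keeps the right
side uniformly Lipschitz. -/
theorem flow_solution_unique {z₁ z₂ : ℝ → ℝ × ℝ} {τ : ℝ → ℝ} {s₀ : ℝ}
    (hτ : ContinuousAt τ s₀)
    (h₁ : ∀ᶠ s in 𝓝 s₀, HasDerivAt z₁ (τ s • X.flow (z₁ s)) s)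
    (h₂ : ∀ᶠ s in 𝓝 s₀, HasDerivAt z₂ (τ s • X.flow (z₂ s)) s)
    (h : z₁ s₀ = z₂ s₀) (hr : (z₁ s₀).1 ∈ X.radii) : z₁ =ᶠ[𝓝 s₀] z₂ := by
  obtain ⟨K, t, ht, hK⟩ :=
    ((X.contDiffAt_flow hr).of_le (by simp : (1 : WithTop ℕ∞) ≤ ∞)).exists_lipschitzOnWith
  have hM : ∀ᶠ s in 𝓝 s₀, ‖τ s‖₊ < ‖τ s₀‖₊ + 1 :=
    hτ.nnnorm.eventually (gt_mem_nhds (lt_add_one _))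
  refine ODE_solution_unique_of_eventually (v := fun s z => τ s • X.flow z)
    (K := (‖τ s₀‖₊ + 1) * K) (s := fun _ => t) (t₀ := s₀) ?_ ?_ ?_ h
  · filter_upwards [hM] with s hs
    refine LipschitzOnWith.of_dist_le_mul fun a ha b hb => ?_
    rw [dist_smul₀, NNReal.coe_mul, mul_assoc]
    exact mul_le_mul (by exact_mod_cast hs.le) (hK.dist_le_mul a ha b hb) dist_nonneg
      (NNReal.coe_nonneg _)
  · exact h₁.and (h₁.self_of_nhds.continuousAt.eventually ht)
  · exact h₂.and (h₂.self_of_nhds.continuousAt.eventually (h ▸ ht))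

variable {X}

theorem IsNullGeodesic.hasDerivAt_norm {ζ : ℝ → Event n} {J : Set ℝ} (h : X.IsNullGeodesic ζ J)
    {s : ℝ} (hs : s ∈ J) :
    HasDerivAt (fun s => ‖(ζ s).2‖) (dr (ζ s) (deriv ζ s)) s :=
  hasDerivAt_norm_curve (hasDerivAt_snd_curve (h.hasDerivAt hs)) (X.snd_ne_zero (h.mapsTo hs))

theorem IsNullGeodesic.fst_deriv_ne_zero {ζ : ℝ → Event n} {J : Set ℝ}
    (h : X.IsNullGeodesic ζ J) {s : ℝ} (hs : s ∈ J) : (deriv ζ s).1 ≠ 0 :=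
  fst_ne_zero_of_null (h.mapsTo hs) (h.velocity_ne_zero s hs) (h.null s hs)

/-- Along a null geodesic, `r` and `q = dr/dt` satisfy the first-order system, up to the
reparametrization by `t`. -/
theorem IsNullGeodesic.hasDerivAt_flow {ζ : ℝ → Event n} {J : Set ℝ} (h : X.IsNullGeodesic ζ J)
    {s : ℝ} (hs : s ∈ J) :
    HasDerivAt (fun s => (‖(ζ s).2‖, dr (ζ s) (deriv ζ s) / (deriv ζ s).1))
      ((deriv ζ s).1 • X.flow (‖(ζ s).2‖, dr (ζ s) (deriv ζ s) / (deriv ζ s).1)) s := by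
  have hx := h.mapsTo hs
  have hr0 := (X.norm_pos hx).ne'
  have hf0 := (X.f_pos _ hx).ne'
  have hτ0 := h.fst_deriv_ne_zero hs
  have hr := h.hasDerivAt_norm hs
  have hu := h.hasDerivAt_deriv hs
  have hm := (hasDerivAt_snd_curve (h.hasDerivAt hs)).inner ℝ (hasDerivAt_snd_curve hu)
  have hq := (hm.fun_div hr hr0).fun_div (hasDerivAt_fst_curve hu) hτ0
  have h0 := h.null s hs
  refine (hr.prodMk hq).congr_deriv ?_
  rw [metric_eq] at h0
  have hyy : inner ℝ (ζ s).2 (ζ s).2 = ‖(ζ s).2‖ ^ 2 := real_inner_self_eq_norm_sq _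
  simp only [flow, force, accel, dr, Prod.smul_mk, smul_eq_mul, inner_smul_right, hyy]
  refine Prod.ext (by field_simp) ?_
  simp only
  -- Nullity replaces `|dy/ds|²`; without this the right side would still depend on the angular
  -- momentum.
  have hW : inner ℝ (deriv ζ s).2 (deriv ζ s).2 = X.f ‖(ζ s).2‖ * (deriv ζ s).1 ^ 2
      - ((X.f ‖(ζ s).2‖)⁻¹ - 1) / ‖(ζ s).2‖ ^ 2 * inner ℝ (ζ s).2 (deriv ζ s).2 ^ 2 := by
    linear_combination h0
  rw [hW]
  field_simp
  ring

/-- Picard–Lindelöf for position and velocity, shrunk to a ball where the position stays in the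
spacetime and the velocity stays nonzero. Nullity propagates by `metricDeriv_self`. -/
theorem exists_isNullGeodesic {x u : Event n} (hx : x ∈ X.carrier) (hu : u ≠ 0)
    (h0 : X.metric x u u = 0) :
    ∃ ζ J, X.IsNullGeodesic ζ J ∧ (0 : ℝ) ∈ J ∧ ζ 0 = x ∧ deriv ζ 0 = u := by
  have hΦ : ContDiffAt ℝ 1 (fun p : Event n × Event n => (p.2, X.accel p.1 p.2)) (x, u) :=
    contDiffAt_snd.prodMk (contDiffAt_accel hx)
  obtain ⟨α, hα0, ε, hε, hα⟩ :=
    hΦ.exists_forall_mem_closedBall_exists_eq_forall_mem_Ioo_hasDerivAt₀ (0 : ℝ)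
  have hev : ∀ᶠ s in 𝓝 (0 : ℝ), HasDerivAt α ((α s).2, X.accel (α s).1 (α s).2) s ∧
      (α s).1 ∈ X.carrier ∧ (α s).2 ≠ 0 := by
    have h1 : ∀ᶠ s in 𝓝 (0 : ℝ), HasDerivAt α ((α s).2, X.accel (α s).1 (α s).2) s := by
      filter_upwards [Ioo_mem_nhds (by linarith : (0 : ℝ) - ε < 0) (by linarith : (0 : ℝ) < 0 + ε)] with s hs
      exact hα s hs
    have hc := h1.self_of_nhds.continuousAt
    refine h1.and (Filter.Eventually.and (hc.fst.preimage_mem_nhds (t := X.carrier) ?_)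
      (hc.snd.preimage_mem_nhds (t := {v | v ≠ 0}) ?_))
    · rw [hα0]; exact X.isOpen_carrier.mem_nhds hx
    · rw [hα0]; exact isOpen_ne.mem_nhds hu
  obtain ⟨δ, hδ, hJ⟩ := Metric.eventually_nhds_iff_ball.1 hev
  have hd : ∀ s ∈ Metric.ball (0 : ℝ) δ, HasDerivAt (fun s => (α s).1) (α s).2 s := fun s hs =>
    hasDerivAt_fst_curve (hJ s hs).1
  have hd2 : ∀ s ∈ Metric.ball (0 : ℝ) δ,
      HasDerivAt (fun s => (α s).2) (X.accel (α s).1 (α s).2) s := fun s hs =>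
    hasDerivAt_snd_curve (hJ s hs).1
  have hderiv : EqOn (deriv fun s => (α s).1) (fun s => (α s).2) (Metric.ball 0 δ) :=
    fun s hs => (hd s hs).deriv
  have hderiv2 : ∀ s ∈ Metric.ball (0 : ℝ) δ, deriv (deriv fun s => (α s).1) s =
      X.accel (α s).1 (α s).2 := fun s hs =>
    ((hd2 s hs).congr_of_eventuallyEq
      (hderiv.eventuallyEq_of_mem (Metric.isOpen_ball.mem_nhds hs))).deriv
  have hord : (Metric.ball (0 : ℝ) δ).OrdConnected := by
    rw [Real.ball_eq_Ioo]; exact ordConnected_Ioo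
  have h0mem : (0 : ℝ) ∈ Metric.ball (0 : ℝ) δ := Metric.mem_ball_self hδ
  -- The velocity is a component of `α`, so `α` of class `C¹` makes the geodesic `C²`.
  have hαc : ContDiffOn ℝ 1 α (Metric.ball 0 δ) := by
    rw [show (1 : WithTop ℕ∞) = 0 + 1 by simp,
      contDiffOn_succ_iff_deriv_of_isOpen Metric.isOpen_ball]
    refine ⟨fun s hs => (hJ s hs).1.differentiableAt.differentiableWithinAt, by simp, ?_⟩
    rw [contDiffOn_zero]
    refine ContinuousOn.congr (f := fun s => ((α s).2, X.accel (α s).1 (α s).2)) (fun s hs => ?_)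
      fun s hs => (hJ s hs).1.deriv
    have hc := (hJ s hs).1.continuousAt
    exact (hc.snd.prodMk (ContinuousAt.comp (f := α) (g := fun p => X.accel p.1 p.2)
      (contDiffAt_accel (hJ s hs).2.1).continuousAt hc)).continuousWithinAt
  refine ⟨fun s => (α s).1, Metric.ball 0 δ, ⟨Metric.isOpen_ball, hord, ⟨0, h0mem⟩,
    fun s hs => (hJ s hs).2.1, ?_, ?_, ?_, ?_⟩, h0mem, by simp [hα0], ?_⟩
  · rw [show (2 : WithTop ℕ∞) = 1 + 1 by norm_num,
      contDiffOn_succ_iff_deriv_of_isOpen Metric.isOpen_ball]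
    exact ⟨fun s hs => (hd s hs).differentiableAt.differentiableWithinAt, by simp,
      hαc.snd.congr hderiv⟩
  · intro s hs
    rw [hderiv hs]
    exact (hJ s hs).2.2
  · intro s hs
    rw [hderiv hs]
    have hm : ∀ s ∈ Metric.ball (0 : ℝ) δ,
        HasDerivAt (fun s => X.metric (α s).1 (α s).2 (α s).2) 0 s := fun s hs =>
      (X.hasDerivAt_metric (hd s hs) (hd2 s hs) (hd2 s hs) (hJ s hs).2.1).congr_deriv
        (X.metricDeriv_self (hJ s hs).2.1 _)
    have := Metric.isOpen_ball.is_const_of_deriv_eq_zero hord.isPreconnected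
      (fun s hs => (hm s hs).differentiableAt.differentiableWithinAt)
      (fun s hs => (hm s hs).deriv) hs h0mem
    simpa only [hα0, h0] using this
  · intro s hs
    rw [X.geodesic_iff (hJ s hs).2.1, hderiv hs, hderiv2 s hs]
  · simp [hderiv h0mem, hα0]

end ClassS

/-! ### Profiles `r = R(t)` and their maximal extension -/

namespace ClassS

variable {n : ℕ} (X : ClassS n)

/-- `r = R(t)`, for `t ∈ T`, is a timelike curve in the `(t, r)`-half plane which solves the
equation satisfied by the null geodesics. -/
structure IsProfile (T : Set ℝ) (R : ℝ → ℝ) : Prop where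
  isOpen : IsOpen T
  ordConnected : T.OrdConnected
  contDiffOn : ContDiffOn ℝ ∞ R T
  mapsTo : MapsTo R T X.radii
  timelike : ∀ t ∈ T, |deriv R t| < X.f (R t)
  ode : ∀ t ∈ T, deriv (deriv R) t = X.force (R t) (deriv R t)

variable {X} {T T' : Set ℝ} {R R' : ℝ → ℝ}

theorem hasDerivAt_of_contDiffOn (hT : IsOpen T) (h : ContDiffOn ℝ ∞ R T) {t : ℝ} (ht : t ∈ T) :
    HasDerivAt R (deriv R t) t :=
  ((h.contDiffAt (hT.mem_nhds ht)).differentiableAt (by simp)).hasDerivAt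

theorem IsProfile.hasDerivAt (h : X.IsProfile T R) {t : ℝ} (ht : t ∈ T) :
    HasDerivAt R (deriv R t) t :=
  hasDerivAt_of_contDiffOn h.isOpen h.contDiffOn ht

theorem IsProfile.hasDerivAt_flow (h : X.IsProfile T R) {t : ℝ} (ht : t ∈ T) :
    HasDerivAt (fun t => (R t, deriv R t)) (X.flow (R t, deriv R t)) t := by
  have h1 := hasDerivAt_of_contDiffOn h.isOpen
    (h.contDiffOn.deriv_of_isOpen (m := ∞) h.isOpen (by simp)) ht
  rw [h.ode t ht] at h1
  exact (h.hasDerivAt ht).prodMk h1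

theorem IsProfile.eventuallyEq (h : X.IsProfile T R) (h' : X.IsProfile T' R') {t : ℝ}
    (ht : t ∈ T) (ht' : t ∈ T') (heq : (R t, deriv R t) = (R' t, deriv R' t)) :
    (fun t => (R t, deriv R t)) =ᶠ[𝓝 t] (fun t => (R' t, deriv R' t)) :=
  X.flow_solution_unique (τ := fun _ => 1) continuousAt_const
    (by filter_upwards [h.isOpen.mem_nhds ht] with s hs; simpa using h.hasDerivAt_flow hs)
    (by filter_upwards [h'.isOpen.mem_nhds ht'] with s hs; simpa using h'.hasDerivAt_flow hs)
    heq (h.mapsTo ht)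

/-- The parameters near which the two solutions coincide form an open set, by local uniqueness. It
is relatively closed in the interval `T ∩ T'`, since values and derivatives pass to limits. -/
theorem IsProfile.eqOn (h : X.IsProfile T R) (h' : X.IsProfile T' R') {t₀ : ℝ}
    (ht : t₀ ∈ T) (ht' : t₀ ∈ T') (h0 : R t₀ = R' t₀) (h1 : deriv R t₀ = deriv R' t₀) :
    EqOn R R' (T ∩ T') := by
  have hpre : IsPreconnected (T ∩ T') := (h.ordConnected.inter h'.ordConnected).isPreconnected
  set z : ℝ → ℝ × ℝ := fun t => (R t, deriv R t)
  set z' : ℝ → ℝ × ℝ := fun t => (R' t, deriv R' t)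
  have hsub := hpre.subset_of_closure_inter_subset (u := {t | z =ᶠ[𝓝 t] z'})
    isOpen_setOfPred_eventually_nhds
    ⟨t₀, ⟨ht, ht'⟩, h.eventuallyEq h' ht ht' (Prod.ext h0 h1)⟩ ?_
  · exact fun t ht => congrArg Prod.fst (hsub ht).self_of_nhds
  · rintro t ⟨htc, ht⟩
    refine h.eventuallyEq h' ht.1 ht.2 ?_
    have hne := mem_closure_iff_nhdsWithin_neBot.1 htc
    refine tendsto_nhds_unique_of_eventuallyEq
      ((h.hasDerivAt_flow ht.1).continuousAt.tendsto.mono_left nhdsWithin_le_nhds)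
      ((h'.hasDerivAt_flow ht.2).continuousAt.tendsto.mono_left nhdsWithin_le_nhds) ?_
      (l := 𝓝[{t | z =ᶠ[𝓝 t] z'}] t)
    filter_upwards [self_mem_nhdsWithin] with s hs using hs.self_of_nhds

theorem contDiffOn_of_hasDerivAt_flow {z : ℝ → ℝ × ℝ} (hT : IsOpen T)
    (hr : ∀ t ∈ T, (z t).1 ∈ X.radii) (hz : ∀ t ∈ T, HasDerivAt z (X.flow (z t)) t) :
    ContDiffOn ℝ ∞ z T := by
  rw [contDiffOn_infty]
  intro k
  induction k with
  | zero =>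
    exact contDiffOn_zero.2 fun t ht => (hz t ht).continuousAt.continuousWithinAt
  | succ k ih =>
    rw [Nat.cast_add, Nat.cast_one, contDiffOn_succ_iff_deriv_of_isOpen hT]
    refine ⟨fun t ht => (hz t ht).differentiableAt.differentiableWithinAt, by simp, ?_⟩
    refine ContDiffOn.congr (f := fun t => X.flow (z t)) (fun t ht => ?_) fun t ht => (hz t ht).deriv
    exact (((X.contDiffAt_flow (hr t ht)).of_le (by exact_mod_cast le_top)).comp t
      ((ih.contDiffAt (hT.mem_nhds ht)))).contDiffWithinAt

theorem exists_isProfile (t₀ : ℝ) {r₀ q₀ : ℝ} (hr : r₀ ∈ X.radii) (hq : |q₀| < X.f r₀) :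
    ∃ T R, X.IsProfile T R ∧ t₀ ∈ T ∧ R t₀ = r₀ ∧ deriv R t₀ = q₀ := by
  obtain ⟨z, hz0, ε, hε, hz⟩ := ((X.contDiffAt_flow (z := (r₀, q₀)) hr).of_le
    (by simp : (1 : WithTop ℕ∞) ≤ ∞)
    ).exists_forall_mem_closedBall_exists_eq_forall_mem_Ioo_hasDerivAt₀ t₀
  have hev : ∀ᶠ t in 𝓝 t₀, HasDerivAt z (X.flow (z t)) t ∧ (z t).1 ∈ X.radii ∧
      |(z t).2| < X.f (z t).1 := by
    have h1 : ∀ᶠ t in 𝓝 t₀, HasDerivAt z (X.flow (z t)) t := by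
      filter_upwards [Ioo_mem_nhds (by linarith : t₀ - ε < t₀) (by linarith : t₀ < t₀ + ε)]
        with s hs using hz s hs
    have hc := h1.self_of_nhds.continuousAt
    refine h1.and (Filter.Eventually.and (hc.fst.preimage_mem_nhds (t := X.radii) ?_)
      (hc.snd.abs.eventually_lt (ContinuousAt.comp (g := X.f) ?_ hc.fst) ?_))
    · rw [hz0]; exact X.isOpen_radii.mem_nhds hr
    · rw [hz0]; exact (X.hasDerivAt_f hr).continuousAt
    · simpa [hz0] using hq
  obtain ⟨δ, hδ, hJ⟩ := Metric.eventually_nhds_iff_ball.1 hev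
  have hord : (Metric.ball t₀ δ).OrdConnected := by
    rw [Real.ball_eq_Ioo]; exact ordConnected_Ioo
  have h0mem : t₀ ∈ Metric.ball t₀ δ := Metric.mem_ball_self hδ
  have hcd := contDiffOn_of_hasDerivAt_flow Metric.isOpen_ball (fun t ht => (hJ t ht).2.1)
    fun t ht => (hJ t ht).1
  have hderiv : EqOn (deriv fun t => (z t).1) (fun t => (z t).2) (Metric.ball t₀ δ) :=
    fun t ht => (hasDerivAt_fst_curve (hJ t ht).1).deriv
  have hderiv2 : ∀ t ∈ Metric.ball t₀ δ, deriv (deriv fun t => (z t).1) t =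
      X.force (z t).1 (z t).2 := fun t ht =>
    ((hasDerivAt_snd_curve (hJ t ht).1).congr_of_eventuallyEq
      (hderiv.eventuallyEq_of_mem (Metric.isOpen_ball.mem_nhds ht))).deriv
  refine ⟨Metric.ball t₀ δ, fun t => (z t).1, ⟨Metric.isOpen_ball, hord, hcd.fst,
    fun t ht => (hJ t ht).2.1, fun t ht => ?_, fun t ht => ?_⟩, h0mem, by simp [hz0], ?_⟩
  · rw [hderiv ht]; exact (hJ t ht).2.2
  · rw [hderiv ht, hderiv2 t ht]
  · simp [hderiv h0mem, hz0]

/-- The defining conditions are local in `t`, so a function glued from profiles inherits them. -/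
theorem IsProfile.congr (h : X.IsProfile T R) {t : ℝ} (ht : t ∈ T) (heq : R' =ᶠ[𝓝 t] R) :
    ContDiffAt ℝ ∞ R' t ∧ R' t ∈ X.radii ∧ |deriv R' t| < X.f (R' t) ∧
      deriv (deriv R') t = X.force (R' t) (deriv R' t) := by
  rw [heq.deriv.deriv_eq, heq.deriv_eq, heq.self_of_nhds]
  exact ⟨(h.contDiffOn.contDiffAt (h.isOpen.mem_nhds ht)).congr_of_eventuallyEq heq,
    h.mapsTo ht, h.timelike t ht, h.ode t ht⟩

/-- There is a largest profile with given initial data. -/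
theorem exists_maximal_isProfile (t₀ : ℝ) {r₀ q₀ : ℝ} (hr : r₀ ∈ X.radii) (hq : |q₀| < X.f r₀) :
    ∃ T R, X.IsProfile T R ∧ t₀ ∈ T ∧ R t₀ = r₀ ∧ deriv R t₀ = q₀ ∧
      ∀ T' R', X.IsProfile T' R' → t₀ ∈ T' → R' t₀ = r₀ → deriv R' t₀ = q₀ →
        T' ⊆ T ∧ EqOn R R' T' := by
  -- The union of all profiles with the given data; `IsProfile.eqOn` makes their values agree on
  -- overlaps, so the choice in `R` is immaterial.
  let A : Set (Set ℝ × (ℝ → ℝ)) :=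
    {p | X.IsProfile p.1 p.2 ∧ t₀ ∈ p.1 ∧ p.2 t₀ = r₀ ∧ deriv p.2 t₀ = q₀}
  let T : Set ℝ := ⋃ p ∈ A, p.1
  have hT : ∀ t ∈ T, ∃ p ∈ A, t ∈ p.1 := fun t ht => by simpa [T] using ht
  choose! p hpA hpt using hT
  let R : ℝ → ℝ := fun t => (p t).2 t
  have hsub : ∀ q ∈ A, q.1 ⊆ T := fun q hq => subset_biUnion_of_mem (u := Prod.fst) hq
  have heq : ∀ q ∈ A, EqOn R q.2 q.1 := by
    intro q hq t ht
    have hp := hpA t (hsub q hq ht)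
    exact hp.1.eqOn hq.1 hp.2.1 hq.2.1 (hp.2.2.1.trans hq.2.2.1.symm)
      (hp.2.2.2.trans hq.2.2.2.symm) ⟨hpt t (hsub q hq ht), ht⟩
  have hev : ∀ q ∈ A, ∀ t ∈ q.1, R =ᶠ[𝓝 t] q.2 := fun q hq t ht =>
    (heq q hq).eventuallyEq_of_mem (hq.1.isOpen.mem_nhds ht)
  have hloc : ∀ t ∈ T, _ := fun t ht =>
    (hpA t ht).1.congr (hpt t ht) (hev _ (hpA t ht) t (hpt t ht))
  obtain ⟨T₁, R₁, h₁⟩ := exists_isProfile t₀ hr hq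
  have h₁A : (T₁, R₁) ∈ A := h₁
  refine ⟨T, R, ⟨isOpen_biUnion fun q hq => hq.1.isOpen, ?_,
    fun t ht => (hloc t ht).1.contDiffWithinAt, fun t ht => (hloc t ht).2.1,
    fun t ht => (hloc t ht).2.2.1, fun t ht => (hloc t ht).2.2.2⟩, hsub _ h₁A h₁.2.1,
    (heq _ h₁A h₁.2.1).trans h₁.2.2.1, (hev _ h₁A t₀ h₁.2.1).deriv_eq.trans h₁.2.2.2,
    fun T' R' h ht hR hR' => ⟨hsub (T', R') ⟨h, ht, hR, hR'⟩, heq (T', R') ⟨h, ht, hR, hR'⟩⟩⟩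
  refine IsPreconnected.ordConnected ?_
  have : T = ⋃₀ (Prod.fst '' A) := by simp [T, sUnion_image]
  rw [this]
  refine isPreconnected_sUnion t₀ _ ?_ ?_
  · rintro _ ⟨q, hq, rfl⟩; exact hq.2.1
  · rintro _ ⟨q, hq, rfl⟩; exact hq.1.ordConnected.isPreconnected

end ClassS

/-! ### Submanifold criteria and curves on spheres -/

theorem surjective_fderiv_of_lines {V W : Type*} [NormedAddCommGroup V] [NormedSpace ℝ V]
    [NormedAddCommGroup W] [NormedSpace ℝ W] {φ : V → W} {x : V} (h : DifferentiableAt ℝ φ x)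
    (hl : ∀ c, ∃ v, HasDerivAt (fun s : ℝ => φ (x + s • v)) c 0) :
    Function.Surjective (fderiv ℝ φ x) := by
  intro c
  obtain ⟨v, hv⟩ := hl c
  refine ⟨v, ?_⟩
  have hlin : HasDerivAt (fun s : ℝ => x + s • v) v 0 := by
    simpa using ((hasDerivAt_id (0 : ℝ)).smul_const v).const_add x
  have hx : x = x + (0 : ℝ) • v := by simp
  have h' : HasFDerivAt φ (fderiv ℝ φ x) (x + (0 : ℝ) • v) := by
    rw [← hx]; exact h.hasFDerivAt
  exact (h'.comp_hasDerivAt 0 hlin).unique hv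

/-- One set of equations valid on one open set suffices for all the lifts, and the submersion
property only needs a line realizing each prescribed velocity of `φ`. -/
theorem isEmbeddedSubmanifold_of_eq {V : Type*} [NormedAddCommGroup V] [NormedSpace ℝ V]
    {d k : ℕ} {S U : Set V} {φ : V → Fin k → ℝ} (hd : d + k = Module.finrank ℝ V)
    (hU : IsOpen U) (hφ : ContDiffOn ℝ ∞ φ U)
    (hl : ∀ x ∈ U, ∀ c, ∃ v, HasDerivAt (fun s : ℝ => φ (x + s • v)) c 0)
    (hS : S = {y | y ∈ U ∧ φ y = 0}) : IsEmbeddedSubmanifold d S := by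
  refine ⟨k, hd, fun x hx => ⟨U, hU, ?_, φ, hφ, fun y hy => ?_, ?_⟩⟩
  · rw [hS] at hx; exact hx.1
  · exact surjective_fderiv_of_lines
      ((hφ.contDiffAt (hU.mem_nhds hy)).differentiableAt (by simp)) (hl y hy)
  · rw [hS]
    ext y
    exact ⟨fun h => h.1, fun h => ⟨h, h.1⟩⟩

section Sphere

variable {E : Type*} [NormedAddCommGroup E] [InnerProductSpace ℝ E] {y w : E} {ρ : ℝ → ℝ}

theorem hasDerivAt_add_smul (y w : E) : HasDerivAt (fun s : ℝ => y + s • w) w 0 := by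
  simpa using ((hasDerivAt_id (0 : ℝ)).smul_const w).const_add y

/-- Rescaling the line `y + s w` to norm `ρ s` does not change its initial velocity when `ρ'`
already is the radial component of `w`. This supplies curves with prescribed velocity inside
rotationally symmetric hypersurfaces. -/
theorem hasDerivAt_rescaled (hy : y ≠ 0) (hρ : HasDerivAt ρ (inner ℝ y w / ‖y‖) 0)
    (h0 : ρ 0 = ‖y‖) :
    HasDerivAt (fun s : ℝ => (ρ s / ‖y + s • w‖) • (y + s • w)) w 0 := by
  have hn : ‖y‖ ≠ 0 := norm_ne_zero_iff.2 hy
  have h1 := hasDerivAt_add_smul y w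
  have h2 := hasDerivAt_norm_curve h1 (by simpa)
  have h3 := (hρ.fun_div h2 (by simpa)).fun_smul h1
  refine h3.congr_deriv ?_
  simp only [h0, zero_smul, add_zero, div_self hn, one_smul]
  rw [mul_comm ‖y‖, sub_self, zero_div, zero_smul, add_zero]

theorem eventually_norm_rescaled (hy : y ≠ 0) (hρ : ContinuousAt ρ 0) (h0 : ρ 0 = ‖y‖) :
    ∀ᶠ s in 𝓝 (0 : ℝ), ‖(ρ s / ‖y + s • w‖) • (y + s • w)‖ = ρ s := by
  have h1 : ∀ᶠ s in 𝓝 (0 : ℝ), 0 < ρ s :=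
    hρ.eventually (lt_mem_nhds (by rw [h0]; exact norm_pos_iff.2 hy))
  have h2 : ∀ᶠ s in 𝓝 (0 : ℝ), y + s • w ≠ 0 :=
    (hasDerivAt_add_smul y w).continuousAt.eventually_ne (by simpa)
  filter_upwards [h1, h2] with s hs hs'
  have : ‖y + s • w‖ ≠ 0 := norm_ne_zero_iff.2 hs'
  rw [norm_smul, norm_div, norm_norm, Real.norm_of_nonneg hs.le]
  field_simp

/-- Angular directions exist because `n ≥ 2`. With `y = 0` the lemma just provides a unit vector. -/
theorem exists_unit_orthogonal {n : ℕ} (hn : 2 ≤ n) (y : EuclideanSpace ℝ (Fin n)) :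
    ∃ e : EuclideanSpace ℝ (Fin n), ‖e‖ = 1 ∧ inner ℝ y e = (0 : ℝ) := by
  have h : (Submodule.span ℝ {y})ᗮ ≠ ⊥ := by
    intro h
    rw [Submodule.orthogonal_eq_bot_iff] at h
    have h1 := finrank_span_le_card (R := ℝ) ({y} : Set (EuclideanSpace ℝ (Fin n)))
    rw [h, finrank_top] at h1
    simp at h1
    omega
  obtain ⟨e, he, he0⟩ := Submodule.exists_mem_ne_zero_of_ne_bot h
  refine ⟨(‖e‖⁻¹ : ℝ) • e, norm_smul_inv_norm he0, ?_⟩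
  rw [inner_smul_right, Submodule.mem_orthogonal_singleton_iff_inner_right.1 he, mul_zero]

end Sphere

theorem finrank_event (n : ℕ) : Module.finrank ℝ (Event n) = n + 1 := by
  simp [Event, add_comm]

theorem tangentVectors_le_ker {V W : Type*} [NormedAddCommGroup V] [NormedSpace ℝ V]
    [NormedAddCommGroup W] [NormedSpace ℝ W] {S U : Set V} {φ : V → W} {x v : V} (hU : U ∈ 𝓝 x)
    (hφ : DifferentiableAt ℝ φ x) (h0 : ∀ y ∈ S ∩ U, φ y = 0) (hv : v ∈ tangentVectors S x) :
    fderiv ℝ φ x v = 0 := by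
  obtain ⟨γ, rfl, hγS, hγ⟩ := hv
  have h1 := hφ.hasFDerivAt.comp_hasDerivAt 0 hγ
  have h2 : φ ∘ γ =ᶠ[𝓝 0] fun _ => 0 := by
    filter_upwards [hγS, hγ.continuousAt hU] with s hs hs'
    exact h0 _ ⟨hs, hs'⟩
  exact h1.unique ((hasDerivAt_const 0 (0 : W)).congr_of_eventuallyEq h2)

/-! ### Spherical photon surfaces are the graphs of profiles -/

namespace ClassS

variable {n : ℕ} {X : ClassS n} {T T' : Set ℝ} {R R' : ℝ → ℝ}

/-- The spherically symmetric hypersurface `r = R(t)`, `t ∈ T`. -/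
def profileGraph (n : ℕ) (T : Set ℝ) (R : ℝ → ℝ) : Set (Event n) :=
  {x | x.1 ∈ T ∧ ‖x.2‖ = R x.1}

theorem mem_tangentVectors_profileGraph {x v : Event n} (hT : IsOpen T) {q : ℝ}
    (hR : HasDerivAt R q x.1) (hx : x ∈ profileGraph n T R) (hx0 : x.2 ≠ 0) :
    v ∈ tangentVectors (profileGraph n T R) x ↔ dr x v = q * v.1 := by
  constructor
  · rintro ⟨γ, rfl, hγS, hγ⟩
    have h1 := hasDerivAt_norm_curve (hasDerivAt_snd_curve hγ) hx0
    have h2 := HasDerivAt.comp (0 : ℝ) hR (hasDerivAt_fst_curve hγ)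
    refine h1.unique (h2.congr_of_eventuallyEq ?_)
    filter_upwards [hγS] with s hs using hs.2
  · intro h
    have h1 : HasDerivAt (fun s : ℝ => x.1 + s • v.1) v.1 0 := hasDerivAt_add_smul _ _
    have h2 : HasDerivAt (fun s : ℝ => R (x.1 + s • v.1)) (q * v.1) 0 :=
      HasDerivAt.comp (h₂ := R) (0 : ℝ) (by simpa using hR) h1
    have h0 : R (x.1 + (0 : ℝ) • v.1) = ‖x.2‖ := by simp [hx.2]
    rw [← h, dr] at h2
    refine ⟨fun s => (x.1 + s • v.1,
      (R (x.1 + s • v.1) / ‖x.2 + s • v.2‖) • (x.2 + s • v.2)), ?_, ?_, ?_⟩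
    · have : ‖x.2‖ ≠ 0 := norm_ne_zero_iff.2 hx0
      ext1
      · simp
      · simp [← hx.2, this]
    · filter_upwards [eventually_norm_rescaled (w := v.2) hx0 h2.continuousAt h0,
        h1.continuousAt.preimage_mem_nhds (t := T) (hT.mem_nhds (by simpa using hx.1))]
        with s hs hs' using ⟨hs', hs⟩
    · exact h1.prodMk (hasDerivAt_rescaled hx0 h2 h0)

theorem IsProfile.snd_ne_zero (h : X.IsProfile T R) {x : Event n}
    (hx : x ∈ profileGraph n T R) : x.2 ≠ 0 := by
  rw [← norm_pos_iff, hx.2]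
  exact X.radii_pos (h.mapsTo hx.1)

theorem IsProfile.subset_carrier (h : X.IsProfile T R) : profileGraph n T R ⊆ X.carrier :=
  fun x hx => by
    rw [carrier, mem_ofPred, hx.2]
    exact h.mapsTo hx.1

theorem IsProfile.mem_tangentVectors (h : X.IsProfile T R) {x v : Event n}
    (hx : x ∈ profileGraph n T R) :
    v ∈ tangentVectors (profileGraph n T R) x ↔ dr x v = deriv R x.1 * v.1 :=
  mem_tangentVectors_profileGraph h.isOpen (h.hasDerivAt hx.1) hx (h.snd_ne_zero hx)

theorem dr_radial {x : Event n} (hx : x.2 ≠ 0) (a c : ℝ) (e : EuclideanSpace ℝ (Fin n))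
    (he : inner ℝ x.2 e = (0 : ℝ)) : dr x (a, (c / ‖x.2‖) • x.2 + e) = c := by
  have : ‖x.2‖ ≠ 0 := norm_ne_zero_iff.2 hx
  simp only [dr, inner_add_right, inner_smul_right, he, real_inner_self_eq_norm_sq]
  field_simp
  simp

theorem norm_sq_radial {x : Event n} (hx : x.2 ≠ 0) (c : ℝ) (e : EuclideanSpace ℝ (Fin n))
    (he : inner ℝ x.2 e = (0 : ℝ)) : ‖(c / ‖x.2‖) • x.2 + e‖ ^ 2 = c ^ 2 + ‖e‖ ^ 2 := by
  have : ‖x.2‖ ≠ 0 := norm_ne_zero_iff.2 hx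
  rw [norm_add_sq_real, inner_smul_left, he, norm_smul, norm_div, norm_norm, Real.norm_eq_abs]
  field_simp
  simp

theorem IsProfile.isEmbeddedSubmanifold (h : X.IsProfile T R) :
    IsEmbeddedSubmanifold n (profileGraph n T R) := by
  refine isEmbeddedSubmanifold_of_eq (k := 1) (U := {x | x.1 ∈ T ∧ x.2 ≠ 0})
    (φ := fun x _ => ‖x.2‖ - R x.1) (finrank_event n).symm
    ((h.isOpen.preimage continuous_fst).inter (isOpen_ne.preimage continuous_snd)) ?_ ?_ ?_
  · intro x hx
    refine ContDiffAt.contDiffWithinAt (contDiffAt_pi.2 fun _ => ?_)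
    exact (contDiffAt_snd.norm ℝ hx.2).sub
      (ContDiffAt.comp x (h.contDiffOn.contDiffAt (h.isOpen.mem_nhds hx.1)) contDiffAt_fst)
  · intro x hx c
    have hr : ‖x.2‖ ≠ 0 := norm_ne_zero_iff.2 hx.2
    refine ⟨(0, (c 0 / ‖x.2‖) • x.2), hasDerivAt_pi.2 fun i => ?_⟩
    have h1 := hasDerivAt_norm_curve (hasDerivAt_add_smul x.2 ((c 0 / ‖x.2‖) • x.2))
      (by simpa using hx.2)
    have h2 := h1.sub_const (R x.1)
    simp only [Prod.fst_add, Prod.smul_fst, smul_zero, add_zero, Prod.snd_add, Prod.smul_snd]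
    refine h2.congr_deriv ?_
    rw [Subsingleton.elim i 0]
    simp only [zero_smul, add_zero, inner_smul_right, real_inner_self_eq_norm_sq]
    field_simp
  · ext x
    simp only [profileGraph, mem_ofPred, funext_iff, Pi.zero_apply, forall_const, sub_eq_zero]
    exact ⟨fun hx => ⟨⟨hx.1, h.snd_ne_zero hx⟩, hx.2⟩, fun hx => ⟨hx.1.1, hx.2⟩⟩

theorem sq_lt_of_timelike {f q : ℝ} (h : |q| < f) : q ^ 2 < f ^ 2 :=
  sq_lt_sq.2 (h.trans_le (le_abs_self f))

/-- Along a null geodesic both `(r, dr/dt)` and `(R(t), R'(t))` solve the system with factor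
`dt/ds`. Being in the surface and tangent to it at `s₀` says that they agree there, hence nearby,
which is again containment and tangency. -/
theorem IsProfile.isPhotonSurface (h : X.IsProfile T R) :
    X.IsPhotonSurface (profileGraph n T R) := by
  refine ⟨⟨h.subset_carrier, h.isEmbeddedSubmanifold, fun x hx => ?_⟩, ?_⟩
  · have hx0 := h.snd_ne_zero hx
    have hf := X.f_pos _ (h.subset_carrier hx)
    have hq := sq_lt_of_timelike (h.timelike _ hx.1)
    refine ⟨(1, (deriv R x.1 / ‖x.2‖) • x.2 + 0), (h.mem_tangentVectors hx).2 ?_, ?_⟩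
    · rw [dr_radial hx0 _ _ _ (by simp), mul_one]
    · rw [metric_self, dr_radial hx0 _ _ _ (by simp), norm_sq_radial hx0 _ _ (by simp)]
      rw [← hx.2] at hq
      have : (X.f ‖x.2‖)⁻¹ * deriv R x.1 ^ 2 < X.f ‖x.2‖ := by
        rw [inv_mul_lt_iff₀ hf]; nlinarith
      simp
      linarith
  · intro ζ J hζ s₀ hs₀ hx hv
    have hev : ∀ᶠ s in 𝓝 s₀, s ∈ J ∧ (ζ s).1 ∈ T :=
      Filter.Eventually.and (hζ.isOpen.mem_nhds hs₀)
        ((hasDerivAt_fst_curve (hζ.hasDerivAt hs₀)).continuousAt.preimage_mem_nhds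
          (h.isOpen.mem_nhds hx.1))
    have hkey := X.flow_solution_unique (s₀ := s₀) (τ := fun s => (deriv ζ s).1)
      (z₁ := fun s => (‖(ζ s).2‖, dr (ζ s) (deriv ζ s) / (deriv ζ s).1))
      (z₂ := fun s => (R (ζ s).1, deriv R (ζ s).1))
      (hasDerivAt_fst_curve (hζ.hasDerivAt_deriv hs₀)).continuousAt
      (by filter_upwards [hev] with s hs using hζ.hasDerivAt_flow hs.1)
      (by
        filter_upwards [hev] with s hs
        exact HasDerivAt.scomp s (h.hasDerivAt_flow hs.2)
          (hasDerivAt_fst_curve (hζ.hasDerivAt hs.1)))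
      (by
        refine Prod.ext hx.2 ?_
        simp only
        rw [div_eq_iff (hζ.fst_deriv_ne_zero hs₀)]
        exact (h.mem_tangentVectors hx).1 hv)
      (h.subset_carrier hx)
    filter_upwards [hkey, hev] with s hs hs'
    have hmem : ζ s ∈ profileGraph n T R := ⟨hs'.2, congrArg Prod.fst hs⟩
    refine ⟨hmem, (h.mem_tangentVectors hmem).2 ?_⟩
    have := congrArg Prod.snd hs
    simp only at this
    rwa [div_eq_iff (hζ.fst_deriv_ne_zero hs'.1)] at this

theorem profileGraph_slice (n : ℕ) (T : Set ℝ) (R : ℝ → ℝ) {t₀ : ℝ} (ht : t₀ ∈ T) :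
    profileGraph n T R ∩ {x | x.1 = t₀} = {x | x.1 = t₀ ∧ ‖x.2‖ = R t₀} := by
  ext x
  constructor
  · rintro ⟨hx, rfl⟩; exact ⟨rfl, hx.2⟩
  · rintro ⟨rfl, hx⟩; exact ⟨⟨ht, hx⟩, rfl⟩

theorem IsProfile.isConnected (h : X.IsProfile T R) (hn : 2 ≤ n) (hT : T.Nonempty) :
    IsConnected (profileGraph n T R) := by
  have hrank : 1 < Module.rank ℝ (EuclideanSpace ℝ (Fin n)) := by
    rw [← Module.finrank_eq_rank]
    simp only [finrank_euclideanSpace, Fintype.card_fin]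
    exact_mod_cast hn
  have h1 : IsConnected (T ×ˢ Metric.sphere (0 : EuclideanSpace ℝ (Fin n)) 1) :=
    IsConnected.prod ⟨hT, h.ordConnected.isPreconnected⟩
      (isConnected_sphere hrank 0 zero_le_one)
  have h2 : profileGraph n T R =
      (fun p : ℝ × EuclideanSpace ℝ (Fin n) => (p.1, R p.1 • p.2)) ''
        (T ×ˢ Metric.sphere (0 : EuclideanSpace ℝ (Fin n)) 1) := by
    ext x
    constructor
    · intro hx
      have hx0 : ‖x.2‖ ≠ 0 := norm_ne_zero_iff.2 (h.snd_ne_zero hx)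
      refine ⟨(x.1, ‖x.2‖⁻¹ • x.2), ⟨hx.1, ?_⟩, ?_⟩
      · simp [norm_smul, hx0]
      · simp [← hx.2, smul_smul, hx0]
    · rintro ⟨p, ⟨hp, hp'⟩, rfl⟩
      refine ⟨hp, ?_⟩
      have : 0 < R p.1 := X.radii_pos (h.mapsTo hp)
      simp only [mem_sphere_zero_iff_norm] at hp'
      simp [norm_smul, hp', this.le]
  rw [h2]
  refine h1.image _ ?_
  have hc : ContinuousOn (fun p : ℝ × EuclideanSpace ℝ (Fin n) => R p.1)
      (T ×ˢ Metric.sphere (0 : EuclideanSpace ℝ (Fin n)) 1) :=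
    h.contDiffOn.continuousOn.comp continuousOn_fst fun p hp => hp.1
  exact continuousOn_fst.prodMk (hc.smul continuousOn_snd)

theorem IsProfile.isSphericalPhotonSurface (h : X.IsProfile T R) (hn : 2 ≤ n)
    (hT : T.Nonempty) : X.IsSphericalPhotonSurface (profileGraph n T R) := by
  refine ⟨h.isPhotonSurface, h.isConnected hn hT, ?_⟩
  rintro t₀ ⟨x, hx, rfl⟩
  exact ⟨R x.1, h.mapsTo hx.1, profileGraph_slice n T R hx.1⟩

/-- In terms of the parametrization by `t`, a spherically symmetric timelike hypersurface is
`r = R(t)` with `R` smooth. -/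
theorem exists_profileGraph {P : Set (Event n)} (hP : X.IsTimelikeHypersurface P)
    (hc : IsConnected P) (hs : X.IsSphericallySymmetric P) :
    ∃ T R, IsOpen T ∧ T.OrdConnected ∧ T.Nonempty ∧ ContDiffOn ℝ ∞ R T ∧ MapsTo R T X.radii ∧
      P = profileGraph n T R := by
  obtain ⟨hcar, ⟨k, hk, hφ⟩, htl⟩ := hP
  obtain rfl : k = 1 := by rw [finrank_event] at hk; omega
  have hR : ∀ t ∈ Prod.fst '' P, ∃ r₀ ∈ X.radii,
      P ∩ {x | x.1 = t} = {x | x.1 = t ∧ ‖x.2‖ = r₀} := by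
    rintro _ ⟨x, hx, rfl⟩
    exact hs x.1 ⟨x, hx, rfl⟩
  choose! R hRr hRs using hR
  have hPg : P = profileGraph n (Prod.fst '' P) R := by
    ext x
    constructor
    · intro hx
      have hx1 : x.1 ∈ Prod.fst '' P := ⟨x, hx, rfl⟩
      have : x ∈ P ∩ {y | y.1 = x.1} := ⟨hx, rfl⟩
      rw [hRs _ hx1] at this
      exact ⟨hx1, this.2⟩
    · intro hx
      have : x ∈ P ∩ {y | y.1 = x.1} := by
        rw [hRs _ hx.1]; exact ⟨rfl, hx.2⟩
      exact this.1
  have hloc : ∀ t ∈ Prod.fst '' P, Prod.fst '' P ∈ 𝓝 t ∧ ContDiffAt ℝ ∞ R t := by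
    rintro _ ⟨x, hx, rfl⟩
    obtain ⟨U, hU, hxU, φ, hφU, hφs, hSU⟩ := hφ x hx
    have hx0 : x.2 ≠ 0 := X.snd_ne_zero (hcar hx)
    have hr0 : ‖x.2‖ ≠ 0 := norm_ne_zero_iff.2 hx0
    have hφx : ContDiffAt ℝ ∞ φ x := hφU.contDiffAt (hU.mem_nhds hxU)
    have hφd : DifferentiableAt ℝ φ x := hφx.differentiableAt (by simp)
    have hzero : ∀ y ∈ P ∩ U, φ y = 0 := fun y hy => by
      rw [hSU] at hy; exact hy.2
    have hker : ∀ v ∈ tangentVectors P x, fderiv ℝ φ x v = 0 := fun v hv =>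
      tangentVectors_le_ker (hU.mem_nhds hxU) hφd hzero hv
    have hxR : ‖x.2‖ = R x.1 := by
      have h := hx
      rw [hPg] at h
      exact h.2
    have hx1 : x.1 ∈ Prod.fst '' P := ⟨x, hx, rfl⟩
    -- Each slice is a full sphere, so the vectors tangent to it are tangent to `P` and killed by
    -- the differential of `φ`; only the `t` and radial directions remain.
    have hrot : ∀ w, inner ℝ x.2 w = (0 : ℝ) → fderiv ℝ φ x (0, w) = 0 := by
      intro w hw
      refine hker _ ⟨fun s => (x.1, (‖x.2‖ / ‖x.2 + s • w‖) • (x.2 + s • w)), ?_, ?_, ?_⟩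
      · simp [hr0]
      · filter_upwards [eventually_norm_rescaled (w := w) (ρ := fun _ => ‖x.2‖) hx0
          continuousAt_const rfl] with s hs
        rw [hPg]
        exact ⟨hx1, hs.trans hxR⟩
      · refine (hasDerivAt_const _ _).prodMk (hasDerivAt_rescaled (ρ := fun _ => ‖x.2‖) hx0 ?_ rfl)
        rw [hw, zero_div]
        exact hasDerivAt_const _ _
    have hdec : ∀ u : Event n, fderiv ℝ φ x u = u.1 • fderiv ℝ φ x (1, 0)
        + (inner ℝ x.2 u.2 / ‖x.2‖ ^ 2 : ℝ) • fderiv ℝ φ x (0, x.2) := by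
      intro u
      have h1 := hrot (u.2 - (inner ℝ x.2 u.2 / ‖x.2‖ ^ 2 : ℝ) • x.2) (by
        rw [inner_sub_right, inner_smul_right, real_inner_self_eq_norm_sq]
        field_simp
        ring)
      have h2 : u = u.1 • ((1, 0) : Event n) + (inner ℝ x.2 u.2 / ‖x.2‖ ^ 2 : ℝ) • (0, x.2)
          + (0, u.2 - (inner ℝ x.2 u.2 / ‖x.2‖ ^ 2 : ℝ) • x.2) := by
        ext1 <;> simp
      conv_lhs => rw [h2]
      rw [map_add, map_add, map_smul, map_smul, h1, add_zero]
    -- A timelike tangent vector has a nonzero time component. If the radial derivative vanished,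
    -- this vector would force the time derivative to vanish too, contradicting surjectivity of the
    -- differential.
    have hrad : fderiv ℝ φ x (0, x.2) ≠ 0 := by
      intro h0
      obtain ⟨v, hv, hvt⟩ := htl x hx
      have hv1 : v.1 ≠ 0 := by
        intro hv1
        have h2 := dr_sq_le x v
        have h3 : 0 ≤ (X.f ‖x.2‖)⁻¹ * dr x v ^ 2 :=
          mul_nonneg (inv_nonneg.2 (X.f_pos _ (hcar hx)).le) (sq_nonneg _)
        rw [metric_self, hv1] at hvt
        nlinarith
      have h1 : fderiv ℝ φ x (1, 0) = 0 := by
        have h := hdec v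
        rw [hker v hv, h0, smul_zero, add_zero] at h
        exact (smul_eq_zero.1 h.symm).resolve_left hv1
      obtain ⟨u, hu⟩ := hφs x hxU 1
      rw [hdec, h0, h1] at hu
      simpa using congrFun hu 0
    -- Restriction to the half plane through `x` leaves one equation in `(t, r)`, solvable for `r`
    -- by the implicit function theorem.
    let L : ℝ × ℝ → Event n := fun p => (p.1, (p.2 / ‖x.2‖) • x.2)
    have hLx : L (x.1, ‖x.2‖) = x := by simp [L, hr0]
    have hL : ContDiff ℝ ∞ L := by
      exact contDiff_fst.prodMk ((contDiff_snd.div_const _).smul contDiff_const)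
    have hg : ContDiffAt ℝ ∞ (fun p => φ (L p) 0) (x.1, ‖x.2‖) :=
      (contDiffAt_pi.1 (ContDiffAt.comp (g := φ) (x.1, ‖x.2‖) (by rwa [hLx]) hL.contDiffAt)) 0
    have hL0 : HasDerivAt (fun b : ℝ => L (x.1, ‖x.2‖ + b • (1 : ℝ)))
        (0, (1 / ‖x.2‖) • x.2) 0 := by
      have h1 := (hasDerivAt_add_smul ‖x.2‖ (1 : ℝ)).div_const ‖x.2‖
      exact (hasDerivAt_const 0 x.1).prodMk (h1.smul_const x.2)
    have hgd : fderiv ℝ (fun p => φ (L p) 0) (x.1, ‖x.2‖) (0, 1) ≠ 0 := by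
      have hline : HasDerivAt (fun b : ℝ => ((x.1, ‖x.2‖ + b • (1 : ℝ)) : ℝ × ℝ)) (0, 1) 0 :=
        (hasDerivAt_const 0 x.1).prodMk (hasDerivAt_add_smul ‖x.2‖ (1 : ℝ))
      have h1 := HasFDerivAt.comp_hasDerivAt (l := fun p => φ (L p) 0) (0 : ℝ)
        (by simpa using (hg.differentiableAt (by simp)).hasFDerivAt) hline
      have h2 := hasDerivAt_pi.1 (HasFDerivAt.comp_hasDerivAt (l := φ) (0 : ℝ)
        (by simpa [hLx] using hφd.hasFDerivAt) hL0) 0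
      rw [h1.unique h2]
      intro h3
      have h4 : ((0, (1 / ‖x.2‖) • x.2) : Event n) = (1 / ‖x.2‖) • (0, x.2) := by simp
      rw [h4, map_smul] at h3
      refine hrad (funext fun i => ?_)
      rw [Subsingleton.elim i 0]
      simpa [hr0] using h3
    have hinv : (fderiv ℝ (fun p => φ (L p) 0) (x.1, ‖x.2‖) ∘L
        ContinuousLinearMap.inr ℝ ℝ ℝ).IsInvertible := by
      refine ⟨ContinuousLinearEquiv.unitsEquivAut ℝ (Units.mk0 _ hgd), ?_⟩
      ext
      simp
    let ψ := hg.implicitFunction (by simp) hinv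
    have hψ0 : ψ x.1 = ‖x.2‖ := hg.implicitFunction_apply_self (by simp) hinv
    have hψs : ContDiffAt ℝ ∞ ψ x.1 := hg.contDiffAt_implicitFunction (by simp) hinv
    have hψe : ∀ᶠ t in 𝓝 x.1, φ (L (t, ψ t)) 0 = φ (L (x.1, ‖x.2‖)) 0 :=
      hg.eventually_apply_implicitFunction (by simp) hinv
    have hLc : ContinuousAt (fun t => L (t, ψ t)) x.1 :=
      ContinuousAt.comp (g := L) hL.continuous.continuousAt
        (continuousAt_id.prodMk hψs.continuousAt)
    have hψU : ∀ᶠ t in 𝓝 x.1, L (t, ψ t) ∈ U :=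
      hLc.preimage_mem_nhds (hU.mem_nhds (by rwa [hψ0, hLx]))
    have hψp : ∀ᶠ t in 𝓝 x.1, 0 < ψ t :=
      hψs.continuousAt.eventually (lt_mem_nhds (by rw [hψ0]; exact norm_pos_iff.2 hx0))
    have hfin : ∀ᶠ t in 𝓝 x.1, t ∈ Prod.fst '' P ∧ R t = ψ t := by
      filter_upwards [hψe, hψU, hψp] with t h1 h2 h3
      have h4 : L (t, ψ t) ∈ P := by
        have : L (t, ψ t) ∈ P ∩ U := by
          rw [hSU]
          refine ⟨h2, funext fun i => ?_⟩
          rw [Subsingleton.elim i 0, h1, hLx, hzero x ⟨hx, hxU⟩]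
        exact this.1
      refine ⟨⟨_, h4, rfl⟩, ?_⟩
      rw [hPg] at h4
      rw [← show ‖(L (t, ψ t)).2‖ = R t from h4.2]
      simp only [L, norm_smul, norm_div, norm_norm, Real.norm_of_nonneg h3.le]
      field_simp
    exact ⟨hfin.mono fun t h => h.1, hψs.congr_of_eventuallyEq (hfin.mono fun t h => h.2)⟩
  refine ⟨Prod.fst '' P, R, isOpen_iff_mem_nhds.2 fun t ht => (hloc t ht).1,
    (hc.image _ continuous_fst.continuousOn).isPreconnected.ordConnected, hc.nonempty.image _,
    fun t ht => (hloc t ht).2.contDiffWithinAt, hRr, hPg⟩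

/-- Timelikeness gives `|R'| < f(R)`. For the equation, a null geodesic tangent to `P` stays
tangent, so `dr/dt = R'(t)` along it; differentiating at the start with `dt/ds = 1` gives `R'' =
force R R'`. -/
theorem IsSphericalPhotonSurface.exists_isProfile {P : Set (Event n)} (hn : 2 ≤ n)
    (hP : X.IsSphericalPhotonSurface P) :
    ∃ T R, X.IsProfile T R ∧ T.Nonempty ∧ P = profileGraph n T R := by
  obtain ⟨⟨htl, hgeo⟩, hc, hs⟩ := hP
  obtain ⟨T, R, hT, hord, hne, hR, hRr, rfl⟩ := exists_profileGraph htl hc hs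
  have hx0 : ∀ x ∈ profileGraph n T R, x.2 ≠ 0 := fun x hx => X.snd_ne_zero (htl.1 hx)
  have htan : ∀ x ∈ profileGraph n T R, ∀ v, v ∈ tangentVectors (profileGraph n T R) x ↔
      dr x v = deriv R x.1 * v.1 := fun x hx v =>
    mem_tangentVectors_profileGraph hT (hasDerivAt_of_contDiffOn hT hR hx.1) hx (hx0 x hx)
  have hpt : ∀ t ∈ T, ∃ x ∈ profileGraph n T R, x.1 = t := by
    intro t ht
    obtain ⟨e, he, -⟩ := exists_unit_orthogonal hn 0
    have h0 : 0 < R t := X.radii_pos (hRr ht)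
    exact ⟨(t, R t • e), ⟨ht, by simp [norm_smul, he, h0.le]⟩, rfl⟩
  have hlt : ∀ t ∈ T, |deriv R t| < X.f (R t) := by
    intro t ht
    obtain ⟨x, hx, rfl⟩ := hpt t ht
    have hf := X.f_pos _ (htl.1 hx)
    obtain ⟨v, hv, hvt⟩ := htl.2.2 x hx
    rw [metric_self, (htan x hx v).1 hv] at hvt
    have h1 := dr_sq_le x v
    rw [(htan x hx v).1 hv] at h1
    rw [← hx.2]
    refine abs_lt_of_sq_lt_sq ?_ hf.le
    by_contra hcon
    push Not at hcon
    have h2 : X.f ‖x.2‖ * v.1 ^ 2 ≤ (X.f ‖x.2‖)⁻¹ * (deriv R x.1 * v.1) ^ 2 := by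
      rw [le_inv_mul_iff₀ hf]
      nlinarith [mul_le_mul_of_nonneg_right hcon (sq_nonneg v.1)]
    linarith
  refine ⟨T, R, ⟨hT, hord, hR, hRr, hlt, fun t ht => ?_⟩, hne, rfl⟩
  obtain ⟨x, hx, rfl⟩ := hpt t ht
  have hf := X.f_pos _ (htl.1 hx)
  have hq := sq_lt_of_timelike (hlt _ ht)
  rw [← hx.2] at hq
  obtain ⟨e, he, hxe⟩ := exists_unit_orthogonal hn x.2
  -- The angular speed that makes the tangent vector with `dt = 1`, `dr = R'` null; it is real
  -- because `|R'| < f`.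
  set c := √(X.f ‖x.2‖ - (X.f ‖x.2‖)⁻¹ * deriv R x.1 ^ 2) with hcdef
  have hc2 : c ^ 2 = X.f ‖x.2‖ - (X.f ‖x.2‖)⁻¹ * deriv R x.1 ^ 2 := by
    refine Real.sq_sqrt ?_
    rw [sub_nonneg, inv_mul_le_iff₀ hf]
    nlinarith
  have hxe' : inner ℝ x.2 (c • e) = (0 : ℝ) := by rw [inner_smul_right, hxe, mul_zero]
  have hdr := dr_radial (hx0 x hx) 1 (deriv R x.1) (c • e) hxe'
  obtain ⟨ζ, J, hζ, h0J, hζ0, hζ0'⟩ := exists_isNullGeodesic (X := X) (x := x)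
    (u := (1, (deriv R x.1 / ‖x.2‖) • x.2 + c • e)) (htl.1 hx)
    (fun h => one_ne_zero (congrArg Prod.fst h)) (by
      rw [metric_self, hdr, norm_sq_radial (hx0 x hx) _ _ hxe', norm_smul, he, mul_one,
        Real.norm_eq_abs, sq_abs, hc2]
      ring)
  have hev := hgeo ζ J hζ 0 h0J (by rwa [hζ0]) (by
    rw [hζ0, hζ0', htan x hx, hdr, mul_one])
  have h1 := hasDerivAt_snd_curve (hζ.hasDerivAt_flow h0J)
  have h2 : HasDerivAt (fun s => deriv R (ζ s).1) (deriv (deriv R) x.1 * 1) 0 := by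
    refine HasDerivAt.comp (h₂ := deriv R) (0 : ℝ) ?_ ?_
    · rw [hζ0]
      exact hasDerivAt_of_contDiffOn hT (hR.deriv_of_isOpen (m := ∞) hT (by simp)) ht
    · have := hasDerivAt_fst_curve (hζ.hasDerivAt h0J)
      rwa [hζ0'] at this
  have h3 := h1.unique (h2.congr_of_eventuallyEq ?_)
  · simp only [hζ0, hζ0', hdr, flow, div_one, one_smul, mul_one] at h3
    rw [← hx.2, h3]
  · filter_upwards [hev, hζ.isOpen.mem_nhds h0J] with s hs hsJ
    rw [div_eq_iff (hζ.fst_deriv_ne_zero hsJ)]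
    exact (htan _ hs.1 _).1 hs.2

end ClassS

/-! ### Covectors in components -/

/-- The component `α(∂_t)` of a covector. -/
noncomputable def timePart (n : ℕ) : Covector n →L[ℝ] ℝ :=
  ContinuousLinearMap.apply ℝ ℝ ((1, 0) : Event n)

/-- The spatial components of a covector. -/
noncomputable def spacePart (n : ℕ) : Covector n →L[ℝ] EuclideanSpace ℝ (Fin n) :=
  LinearMap.toContinuousLinearMap
    { toFun := fun α => WithLp.toLp 2 fun i => α (0, EuclideanSpace.single i (1 : ℝ))
      map_add' := fun α β => by ext i; simp
      map_smul' := fun c α => by ext i; simp }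

/-- The covector with components `a` and `b`. -/
noncomputable def covectorMk {n : ℕ} (a : ℝ) (b : EuclideanSpace ℝ (Fin n)) : Covector n :=
  a • ContinuousLinearMap.fst ℝ ℝ (EuclideanSpace ℝ (Fin n)) +
    (innerSL ℝ b).comp (ContinuousLinearMap.snd ℝ ℝ (EuclideanSpace ℝ (Fin n)))

section Covector

variable {n : ℕ}

theorem timePart_apply (α : Covector n) : timePart n α = α (1, 0) := rfl

theorem timePart_covectorMk (a : ℝ) (b : EuclideanSpace ℝ (Fin n)) :
    timePart n (covectorMk a b) = a := by
  simp [timePart_apply, covectorMk]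

theorem spacePart_covectorMk (a : ℝ) (b : EuclideanSpace ℝ (Fin n)) :
    spacePart n (covectorMk a b) = b := by
  ext i
  simp [spacePart, covectorMk, EuclideanSpace.inner_single_right]

/-- Identifies the coordinatewise definition, which is visibly linear, with the Riesz vector
occurring in `sharp`. -/
theorem spacePart_eq (α : Covector n) : spacePart n α =
    (InnerProductSpace.toDual ℝ (EuclideanSpace ℝ (Fin n))).symm
      (α.comp (ContinuousLinearMap.inr ℝ ℝ (EuclideanSpace ℝ (Fin n)))) := by
  ext i
  have h := InnerProductSpace.toDual_symm_apply (𝕜 := ℝ)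
    (x := EuclideanSpace.single i (1 : ℝ))
    (y := α.comp (ContinuousLinearMap.inr ℝ ℝ (EuclideanSpace ℝ (Fin n))))
  rw [EuclideanSpace.inner_single_right] at h
  simpa [spacePart] using h.symm

theorem finrank_cotangent (n : ℕ) : Module.finrank ℝ (Event n × Covector n) = 2 * n + 2 := by
  have h : Module.finrank ℝ (Covector n) = n + 1 := by
    rw [← finrank_event n, ← Subspace.dual_finrank_eq (K := ℝ) (V := Event n)]
    exact (LinearMap.toContinuousLinearMap (𝕜 := ℝ) (E := Event n) (F' := ℝ)).symm.finrank_eq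
  rw [Module.finrank_prod, finrank_event, h]
  ring

end Covector

/-! ### Null lifts of photon surfaces -/

namespace ClassS

variable {n : ℕ} {X : ClassS n} {T T' : Set ℝ} {R R' : ℝ → ℝ}

theorem sharp_fst (x : Event n) (α : Covector n) :
    (X.sharp x α).1 = -(X.f ‖x.2‖)⁻¹ * timePart n α := rfl

theorem sharp_snd (x : Event n) (α : Covector n) :
    (X.sharp x α).2 = spacePart n α +
      ((X.f ‖x.2‖ - 1) * inner ℝ x.2 (spacePart n α) / ‖x.2‖ ^ 2) • x.2 := by
  rw [spacePart_eq]
  rfl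

theorem dr_sharp {x : Event n} (hx : x ∈ X.carrier) (α : Covector n) :
    dr x (X.sharp x α) = X.f ‖x.2‖ * inner ℝ x.2 (spacePart n α) / ‖x.2‖ := by
  have hr := (X.norm_pos hx).ne'
  rw [dr, sharp_snd, inner_add_right, inner_smul_right, real_inner_self_eq_norm_sq]
  field_simp
  ring

theorem metric_sharp_self {x : Event n} (hx : x ∈ X.carrier) (α : Covector n) :
    X.metric x (X.sharp x α) (X.sharp x α) = -(X.f ‖x.2‖)⁻¹ * timePart n α ^ 2
      + ‖spacePart n α‖ ^ 2
      + (X.f ‖x.2‖ - 1) * inner ℝ x.2 (spacePart n α) ^ 2 / ‖x.2‖ ^ 2 := by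
  have hr := (X.norm_pos hx).ne'
  have hf := (X.f_pos _ hx).ne'
  rw [metric_self, dr_sharp hx, sharp_fst, sharp_snd, norm_add_sq_real, inner_smul_right,
    norm_smul, mul_pow, mul_pow _ ‖x.2‖, Real.norm_eq_abs, sq_abs, real_inner_comm]
  field_simp
  ring

theorem sharp_ne_zero {x : Event n} (hx : x ∈ X.carrier) {α : Covector n} (hα : α ≠ 0) :
    X.sharp x α ≠ 0 := by
  intro h
  refine hα (ContinuousLinearMap.ext fun v => ?_)
  rw [← X.metric_sharp hx, h]
  simp [metric_eq]

theorem sharp_fst_ne_zero {p : Event n × Covector n} (hp : p ∈ X.nullSection) :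
    (X.sharp p.1 p.2).1 ≠ 0 :=
  fst_ne_zero_of_null hp.1 (sharp_ne_zero hp.1 hp.2.1) hp.2.2

theorem exists_mem_profileGraph (hn : 2 ≤ n) {t : ℝ} (ht : t ∈ T) (h0 : 0 < R t) :
    ∃ x ∈ profileGraph n T R, x.1 = t := by
  obtain ⟨e, he, -⟩ := exists_unit_orthogonal hn 0
  exact ⟨(t, R t • e), ⟨ht, by simp [norm_smul, he, h0.le]⟩, rfl⟩

theorem IsProfile.subset_iff (h : X.IsProfile T R) (hn : 2 ≤ n) :
    profileGraph n T R ⊆ profileGraph n T' R' ↔ T ⊆ T' ∧ EqOn R R' T := by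
  constructor
  · intro hsub
    have key : ∀ t ∈ T, t ∈ T' ∧ R t = R' t := by
      intro t ht
      obtain ⟨x, hx, rfl⟩ := exists_mem_profileGraph hn ht (X.radii_pos (h.mapsTo ht))
      exact ⟨(hsub hx).1, hx.2.symm.trans (hsub hx).2⟩
    exact ⟨fun t ht => (key t ht).1, fun t ht => (key t ht).2⟩
  · rintro ⟨h1, h2⟩ x hx
    exact ⟨h1 hx.1, hx.2.trans (h2 hx.1)⟩

/-- There is a maximal spherical photon surface through given initial data, and every spherical
photon surface with these data is contained in it. -/
theorem exists_isMaximalSphericalPhotonSurface (hn : 2 ≤ n) (t₀ : ℝ) {r₀ q₀ : ℝ}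
    (hr : r₀ ∈ X.radii) (hq : |q₀| < X.f r₀) :
    ∃ T R, X.IsProfile T R ∧ t₀ ∈ T ∧ R t₀ = r₀ ∧ deriv R t₀ = q₀ ∧
      X.IsMaximalSphericalPhotonSurface (profileGraph n T R) ∧
      ∀ T' R', X.IsProfile T' R' → t₀ ∈ T' → R' t₀ = r₀ → deriv R' t₀ = q₀ →
        profileGraph n T' R' ⊆ profileGraph n T R := by
  obtain ⟨T, R, h, ht, hR, hR', hmax⟩ := exists_maximal_isProfile t₀ hr hq
  have hmax' : ∀ T' R', X.IsProfile T' R' → t₀ ∈ T' → R' t₀ = r₀ → deriv R' t₀ = q₀ →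
      profileGraph n T' R' ⊆ profileGraph n T R := fun T' R' h' h1 h2 h3 =>
    (h'.subset_iff hn).2 ⟨(hmax T' R' h' h1 h2 h3).1, (hmax T' R' h' h1 h2 h3).2.symm⟩
  refine ⟨T, R, h, ht, hR, hR', ⟨h.isSphericalPhotonSurface hn ⟨t₀, ht⟩, fun Q hQ hsub => ?_⟩,
    hmax'⟩
  -- A larger surface is again the graph of a profile, which agrees with `R` on the open set `T` and
  -- so has the same data at `t₀`.
  obtain ⟨T', R', h', -, rfl⟩ := hQ.exists_isProfile hn
  have h1 := (h.subset_iff hn).1 hsub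
  refine (hmax' T' R' h' (h1.1 ht) ((h1.2 ht).symm.trans hR) ?_).antisymm hsub
  rw [← hR']
  exact ((h1.2.eventuallyEq_of_mem (h.isOpen.mem_nhds ht)).deriv_eq).symm

theorem IsProfile.mem_nullLift (h : X.IsProfile T R) {p : Event n × Covector n} :
    p ∈ X.nullLift (profileGraph n T R) ↔ p ∈ X.nullSection ∧ p.1 ∈ profileGraph n T R ∧
      dr p.1 (X.sharp p.1 p.2) = deriv R p.1.1 * (X.sharp p.1 p.2).1 :=
  and_congr_right fun _ => and_congr_right fun hp => h.mem_tangentVectors hp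

/-- Maximal spherical photon surfaces whose lifts meet are equal. -/
theorem IsMaximalSphericalPhotonSurface.eq_of_mem_nullLift (hn : 2 ≤ n) {P P' : Set (Event n)}
    (hP : X.IsMaximalSphericalPhotonSurface P) (hP' : X.IsMaximalSphericalPhotonSurface P')
    {p : Event n × Covector n} (hp : p ∈ X.nullLift P) (hp' : p ∈ X.nullLift P') : P = P' := by
  obtain ⟨T, R, h, -, rfl⟩ := hP.1.exists_isProfile hn
  obtain ⟨T', R', h', -, rfl⟩ := hP'.1.exists_isProfile hn
  rw [h.mem_nullLift] at hp
  rw [h'.mem_nullLift] at hp'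
  have ht := hp.2.1.1
  have hR : R' p.1.1 = R p.1.1 := hp'.2.1.2.symm.trans hp.2.1.2
  have hd : deriv R' p.1.1 = deriv R p.1.1 :=
    mul_right_cancel₀ (sharp_fst_ne_zero hp.1) (hp'.2.2.symm.trans hp.2.2)
  -- Both surfaces lie in the maximal one with the common data, so by their own maximality both
  -- equal it.
  obtain ⟨S, Q, hS, -, -, -, hmax, hsub⟩ := exists_isMaximalSphericalPhotonSurface hn p.1.1
    (h.mapsTo ht) (h.timelike _ ht)
  rw [← hP.2 _ hmax.1 (hsub T R h ht rfl rfl), ← hP'.2 _ hmax.1 (hsub T' R' h' hp'.2.1.1 hR hd)]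

/-- The coefficient `κ` of the equation `⟨y, b⟩ + κ a = 0` of the null lift. -/
noncomputable def liftSlope (X : ClassS n) (R : ℝ → ℝ) (t : ℝ) : ℝ :=
  R t * deriv R t / X.f (R t) ^ 2

/-- The coefficient `μ` of the equation `|b|² = μ a²` of the null lift. -/
noncomputable def liftSize (X : ClassS n) (R : ℝ → ℝ) (t : ℝ) : ℝ :=
  (X.f (R t))⁻¹ - (X.f (R t) - 1) * X.liftSlope R t ^ 2 / R t ^ 2

theorem IsProfile.contDiffOn_liftSlope (h : X.IsProfile T R) :
    ContDiffOn ℝ ∞ (X.liftSlope R) T :=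
  (h.contDiffOn.mul (h.contDiffOn.deriv_of_isOpen (m := ∞) h.isOpen (by simp))).div
    ((X.contDiffOn_f.comp h.contDiffOn h.mapsTo).pow 2)
    fun _ ht => pow_ne_zero 2 (X.f_pos _ (h.mapsTo ht)).ne'

theorem IsProfile.contDiffOn_liftSize (h : X.IsProfile T R) :
    ContDiffOn ℝ ∞ (X.liftSize R) T := by
  have hf : ContDiffOn ℝ ∞ (fun t => X.f (R t)) T := X.contDiffOn_f.comp h.contDiffOn h.mapsTo
  exact (hf.inv fun t ht => (X.f_pos _ (h.mapsTo ht)).ne').sub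
    (((hf.sub contDiffOn_const).mul (h.contDiffOn_liftSlope.pow 2)).div (h.contDiffOn.pow 2)
      fun t ht => pow_ne_zero 2 (X.radii_pos (h.mapsTo ht)).ne')

/-- On the lift this is the squared angular part of `b` divided by `a²`. It equals `(f² - R'²) /
f³`, so timelikeness is exactly its positivity. -/
theorem IsProfile.liftSize_pos (h : X.IsProfile T R) {t : ℝ} (ht : t ∈ T) :
    0 < X.liftSize R t - X.liftSlope R t ^ 2 / R t ^ 2 := by
  have hr : 0 < R t := X.radii_pos (h.mapsTo ht)
  have hf := X.f_pos _ (h.mapsTo ht)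
  have hq := sq_lt_of_timelike (h.timelike t ht)
  have : X.liftSize R t - X.liftSlope R t ^ 2 / R t ^ 2 =
      (X.f (R t) ^ 2 - deriv R t ^ 2) / X.f (R t) ^ 3 := by
    rw [liftSize, liftSlope]
    field_simp
    ring
  rw [this]
  exact div_pos (by linarith) (by positivity)

/-- The Gram determinant of position and spatial momentum. -/
noncomputable def gram (p : Event n × Covector n) : ℝ :=
  ‖p.1.2‖ ^ 2 * ‖spacePart n p.2‖ ^ 2 - inner ℝ p.1.2 (spacePart n p.2) ^ 2

theorem contDiff_spacePart :
    ContDiff ℝ ∞ fun p : Event n × Covector n => spacePart n p.2 :=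
  (spacePart n).contDiff.comp contDiff_snd

theorem contDiff_timePart :
    ContDiff ℝ ∞ fun p : Event n × Covector n => timePart n p.2 :=
  (timePart n).contDiff.comp contDiff_snd

theorem contDiff_position :
    ContDiff ℝ ∞ fun p : Event n × Covector n => p.1.2 := contDiff_snd.comp contDiff_fst

theorem contDiff_time :
    ContDiff ℝ ∞ fun p : Event n × Covector n => p.1.1 := contDiff_fst.comp contDiff_fst

theorem continuous_gram : Continuous (gram (n := n)) := by
  have h1 := (contDiff_spacePart (n := n)).continuous
  have h2 := (contDiff_position (n := n)).continuous
  exact ((h2.norm.pow 2).mul (h1.norm.pow 2)).sub ((h2.inner h1).pow 2)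

/-- The null lift of a photon surface in terms of polynomial equations in the fibres. -/
theorem IsProfile.mem_nullLift_iff (h : X.IsProfile T R) {p : Event n × Covector n} :
    p ∈ X.nullLift (profileGraph n T R) ↔ (p.1.1 ∈ T ∧ 0 < gram p) ∧
      ‖p.1.2‖ ^ 2 - R p.1.1 ^ 2 = 0 ∧
      inner ℝ p.1.2 (spacePart n p.2) + X.liftSlope R p.1.1 * timePart n p.2 = 0 ∧
      ‖spacePart n p.2‖ ^ 2 - X.liftSize R p.1.1 * timePart n p.2 ^ 2 = 0 := by
  rw [h.mem_nullLift]
  constructor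
  · rintro ⟨hnull, hx, htan⟩
    have ha : timePart n p.2 ≠ 0 := fun h0 =>
      sharp_fst_ne_zero hnull (by rw [sharp_fst, h0, mul_zero])
    have hr := X.norm_pos hnull.1
    have hf := X.f_pos _ hnull.1
    have h0 := hnull.2.2
    have hpos := h.liftSize_pos hx.1
    rw [metric_sharp_self hnull.1] at h0
    rw [dr_sharp hnull.1, sharp_fst] at htan
    have h1 : inner ℝ p.1.2 (spacePart n p.2) + X.liftSlope R p.1.1 * timePart n p.2 = 0 := by
      rw [liftSlope, ← hx.2]
      field_simp at htan ⊢
      linear_combination htan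
    have hyb : inner ℝ p.1.2 (spacePart n p.2) = -(X.liftSlope R p.1.1 * timePart n p.2) := by
      linear_combination h1
    have h2 : ‖spacePart n p.2‖ ^ 2 - X.liftSize R p.1.1 * timePart n p.2 ^ 2 = 0 := by
      rw [hyb] at h0
      rw [liftSize, ← hx.2]
      linear_combination h0
    refine ⟨⟨hx.1, ?_⟩, by rw [hx.2, sub_self], h1, h2⟩
    have h3 : gram p = (timePart n p.2) ^ 2 * R p.1.1 ^ 2 *
        (X.liftSize R p.1.1 - X.liftSlope R p.1.1 ^ 2 / R p.1.1 ^ 2) := by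
      rw [hx.2] at hr
      rw [gram, hyb, sub_eq_zero.1 h2, hx.2]
      field_simp
    rw [h3]
    rw [hx.2] at hr
    positivity
  · rintro ⟨⟨ht, hg⟩, h0, h1, h2⟩
    have hR : 0 < R p.1.1 := X.radii_pos (h.mapsTo ht)
    have hx : ‖p.1.2‖ = R p.1.1 :=
      (sq_eq_sq₀ (norm_nonneg _) hR.le).1 (sub_eq_zero.1 h0)
    have hmem : p.1 ∈ profileGraph n T R := ⟨ht, hx⟩
    have hc := h.subset_carrier hmem
    have hr := X.norm_pos hc
    have hf := X.f_pos _ hc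
    have hyb : inner ℝ p.1.2 (spacePart n p.2) = -(X.liftSlope R p.1.1 * timePart n p.2) := by
      linear_combination h1
    refine ⟨⟨hc, ?_, ?_⟩, hmem, ?_⟩
    · intro hα
      simp [gram, hα] at hg
    · rw [metric_sharp_self hc, sub_eq_zero.1 h2, hyb, liftSize, hx]
      ring
    · rw [dr_sharp hc, sharp_fst, hyb, liftSlope, ← hx]
      field_simp

/-- Take `a = 1`, give `b` the radial component `-κ/R` dictated by tangency, and supply the rest of
`|b|² = μ` in a direction orthogonal to `y`. -/
theorem IsProfile.nullLift_nonempty (h : X.IsProfile T R) (hn : 2 ≤ n) (hT : T.Nonempty) :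
    (X.nullLift (profileGraph n T R)).Nonempty := by
  obtain ⟨t, ht⟩ := hT
  have hR : 0 < R t := X.radii_pos (h.mapsTo ht)
  obtain ⟨x, hx, rfl⟩ := exists_mem_profileGraph hn ht hR
  obtain ⟨e, he, hxe⟩ := exists_unit_orthogonal hn x.2
  have hpos := h.liftSize_pos hx.1
  set c := √(X.liftSize R x.1 - X.liftSlope R x.1 ^ 2 / R x.1 ^ 2) with hc
  have hc2 : c ^ 2 = X.liftSize R x.1 - X.liftSlope R x.1 ^ 2 / R x.1 ^ 2 := Real.sq_sqrt hpos.le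
  have hxe' : inner ℝ x.2 (c • e) = (0 : ℝ) := by rw [inner_smul_right, hxe, mul_zero]
  have hx0 := h.snd_ne_zero hx
  set b := ((-X.liftSlope R x.1 / R x.1) / ‖x.2‖) • x.2 + c • e with hb
  have hb2 : ‖b‖ ^ 2 = X.liftSize R x.1 := by
    rw [hb, norm_sq_radial hx0 _ _ hxe', norm_smul, he, mul_one, Real.norm_eq_abs, sq_abs, hc2]
    field_simp
    ring
  have hyb : inner ℝ x.2 b = -X.liftSlope R x.1 := by
    rw [hb, inner_add_right, hxe', inner_smul_right, real_inner_self_eq_norm_sq, hx.2]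
    field_simp
    ring
  refine ⟨(x, covectorMk 1 b), h.mem_nullLift_iff.2 ⟨⟨hx.1, ?_⟩, ?_, ?_, ?_⟩⟩
  · rw [gram]
    simp only [spacePart_covectorMk, hb2, hyb, hx.2]
    have : R x.1 ^ 2 * X.liftSize R x.1 - (-X.liftSlope R x.1) ^ 2 = R x.1 ^ 2 * c ^ 2 := by
      rw [hc2]
      field_simp
    rw [this, hc2]
    positivity
  · simp [hx.2]
  · simp [spacePart_covectorMk, timePart_covectorMk, hyb]
  · simp [spacePart_covectorMk, timePart_covectorMk, hb2]

/-- A positive Gram determinant means that `y` and `b` are independent. Keeping `t` and `a` fixed, a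
radial change of `y` moves the first equation, and a change of `b` with prescribed products with `y`
and `b` moves the other two. -/
theorem IsProfile.isEmbeddedSubmanifold_nullLift (h : X.IsProfile T R) (hn : 2 ≤ n) :
    IsEmbeddedSubmanifold (2 * n - 1) (X.nullLift (profileGraph n T R)) := by
  refine isEmbeddedSubmanifold_of_eq (k := 3) (U := {p | p.1.1 ∈ T ∧ 0 < gram p})
    (φ := fun p => ![‖p.1.2‖ ^ 2 - R p.1.1 ^ 2,
      inner ℝ p.1.2 (spacePart n p.2) + X.liftSlope R p.1.1 * timePart n p.2,
      ‖spacePart n p.2‖ ^ 2 - X.liftSize R p.1.1 * timePart n p.2 ^ 2])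
    (by rw [finrank_cotangent]; omega)
    ((h.isOpen.preimage contDiff_time.continuous).inter
      (isOpen_lt continuous_const continuous_gram)) ?_ ?_ ?_
  · intro p hp
    refine ContDiffAt.contDiffWithinAt (contDiffAt_pi.2 fun i => ?_)
    have hcomp : ∀ {g : ℝ → ℝ}, ContDiffOn ℝ ∞ g T →
        ContDiffAt ℝ ∞ (fun p : Event n × Covector n => g p.1.1) p := fun {g} hg =>
      ContDiffAt.comp (g := g) p (hg.contDiffAt (h.isOpen.mem_nhds hp.1)) contDiff_time.contDiffAt
    have hy := (contDiff_position (n := n)).contDiffAt (x := p)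
    have ha := (contDiff_timePart (n := n)).contDiffAt (x := p)
    have hb := (contDiff_spacePart (n := n)).contDiffAt (x := p)
    fin_cases i
    · exact (hy.norm_sq ℝ).sub ((hcomp h.contDiffOn).pow 2)
    · exact (hy.inner ℝ hb).add ((hcomp h.contDiffOn_liftSlope).mul ha)
    · exact (hb.norm_sq ℝ).sub ((hcomp h.contDiffOn_liftSize).mul (ha.pow 2))
  · rintro ⟨⟨t, y⟩, α⟩ ⟨-, hg⟩ c
    set b := spacePart n α with hb
    have hg' : ‖y‖ ^ 2 * ‖b‖ ^ 2 - inner ℝ y b ^ 2 ≠ 0 := hg.ne'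
    have hy : ‖y‖ ≠ 0 := by
      intro h0
      have : y = 0 := norm_eq_zero.1 h0
      simp [this] at hg'
    -- `l` realizes the first component, `d` corrects the second for the effect of moving `y`, and
    -- `b'` solves `⟨y, b'⟩ = d`, `⟨b, b'⟩ = c 2 / 2` by Cramer's rule.
    set l := c 0 / (2 * ‖y‖ ^ 2) with hl
    set d := c 1 - l * inner ℝ y b with hd
    set b' := ((d * ‖b‖ ^ 2 - inner ℝ y b * c 2 / 2) / (‖y‖ ^ 2 * ‖b‖ ^ 2 - inner ℝ y b ^ 2)) • y
      + ((‖y‖ ^ 2 * c 2 / 2 - inner ℝ y b * d) / (‖y‖ ^ 2 * ‖b‖ ^ 2 - inner ℝ y b ^ 2)) • b with hb'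
    have hyb' : inner ℝ y b' = d := by
      rw [hb', inner_add_right, inner_smul_right, inner_smul_right, real_inner_self_eq_norm_sq,
        div_mul_eq_mul_div, div_mul_eq_mul_div, ← add_div, div_eq_iff hg']
      ring
    have hbb' : inner ℝ b b' = c 2 / 2 := by
      rw [hb', inner_add_right, inner_smul_right, inner_smul_right, real_inner_self_eq_norm_sq,
        real_inner_comm y b, div_mul_eq_mul_div, div_mul_eq_mul_div, ← add_div, div_eq_iff hg']
      ring
    have h1 := hasDerivAt_add_smul y (l • y)
    have h2 := hasDerivAt_add_smul b b'
    refine ⟨((0, l • y), covectorMk 0 b'), hasDerivAt_pi.2 fun i => ?_⟩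
    simp only [Prod.fst_add, Prod.snd_add, Prod.smul_fst, Prod.smul_snd, map_add, map_smul,
      spacePart_covectorMk, timePart_covectorMk, smul_zero, add_zero, ← hb]
    fin_cases i
    · refine (h1.norm_sq.sub_const _).congr_deriv ?_
      simp only [zero_smul, add_zero, inner_smul_right, real_inner_self_eq_norm_sq, hl]
      field_simp
      simp
    · refine ((h1.inner ℝ h2).add_const _).congr_deriv ?_
      simp only [zero_smul, add_zero, hyb', inner_smul_left, conj_trivial, hd]
      simp
    · refine (h2.norm_sq.sub_const _).congr_deriv ?_
      simp only [zero_smul, add_zero, hbb']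
      exact mul_div_cancel₀ _ two_ne_zero
  · ext p
    rw [h.mem_nullLift_iff]
    simp only [mem_ofPred, funext_iff, Fin.forall_fin_succ]
    simp

end ClassS

/-! ### Null cones, radial geodesics and principal null hypersurfaces -/

namespace ClassS

variable {n : ℕ} {X : ClassS n}

theorem exists_tortoise (X : ClassS n) :
    ∃ F : ℝ → ℝ, ∀ r ∈ X.radii, HasDerivAt F (X.f r)⁻¹ r := by
  rcases X.radii.eq_empty_or_nonempty with h | ⟨r₀, hr₀⟩
  · exact ⟨0, by simp [h]⟩
  · have hc : ContinuousOn (fun r => (X.f r)⁻¹) X.radii :=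
      X.contDiffOn_f.continuousOn.inv₀ fun r hr => (X.f_pos r hr).ne'
    refine ⟨fun r => ∫ u in r₀..r, (X.f u)⁻¹, fun r hr => ?_⟩
    refine intervalIntegral.integral_hasDerivAt_right
      (hc.mono (X.ordConnected_radii.uIcc_subset hr₀ hr)).intervalIntegrable ?_
      (hc.continuousAt (X.isOpen_radii.mem_nhds hr))
    exact hc.stronglyMeasurableAtFilter X.isOpen_radii r hr

/-- The tortoise coordinate, an antiderivative of `1 / f`. -/
noncomputable def tortoise (X : ClassS n) : ℝ → ℝ := X.exists_tortoise.choose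

theorem hasDerivAt_tortoise {r : ℝ} (hr : r ∈ X.radii) : HasDerivAt X.tortoise (X.f r)⁻¹ r :=
  X.exists_tortoise.choose_spec r hr

theorem contDiffOn_tortoise : ContDiffOn ℝ ∞ X.tortoise X.radii := by
  rw [contDiffOn_infty_iff_deriv_of_isOpen X.isOpen_radii]
  exact ⟨fun r hr => (hasDerivAt_tortoise hr).differentiableAt.differentiableWithinAt,
    (X.contDiffOn_f.inv fun r hr => (X.f_pos r hr).ne').congr
      fun r hr => (hasDerivAt_tortoise hr).deriv⟩

/-- The null hypersurface `t = c + σ F(r)`, with `F` the tortoise coordinate and `σ = ±1`. -/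
def nullCone (X : ClassS n) (σ c : ℝ) : Set (Event n) :=
  {x | x ∈ X.carrier ∧ x.1 = c + σ * X.tortoise ‖x.2‖}

theorem mem_tangentVectors_nullCone {σ c : ℝ} {x v : Event n} (hx : x ∈ X.nullCone σ c) :
    v ∈ tangentVectors (X.nullCone σ c) x ↔ v.1 = σ * ((X.f ‖x.2‖)⁻¹ * dr x v) := by
  constructor
  · rintro ⟨γ, rfl, hγS, hγ⟩
    have h1 := hasDerivAt_norm_curve (hasDerivAt_snd_curve hγ) (X.snd_ne_zero hx.1)
    have h2 := ((hasDerivAt_tortoise hx.1).comp (0 : ℝ) h1).const_mul σ |>.const_add c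
    refine (hasDerivAt_fst_curve hγ).unique (h2.congr_of_eventuallyEq ?_)
    filter_upwards [hγS] with s hs using hs.2
  · intro h
    have h1 := hasDerivAt_add_smul x.2 v.2
    have h2 := hasDerivAt_norm_curve h1 (by simpa using X.snd_ne_zero hx.1)
    have h3 := (HasDerivAt.comp (h₂ := X.tortoise) (0 : ℝ)
      (by simpa using hasDerivAt_tortoise hx.1) h2).const_mul σ |>.const_add c
    refine ⟨fun s => (c + σ * X.tortoise ‖x.2 + s • v.2‖, x.2 + s • v.2), ?_, ?_, ?_⟩
    · ext1
      · simp [hx.2]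
      · simp
    · filter_upwards [(h1.continuousAt.norm).preimage_mem_nhds
        (X.isOpen_radii.mem_nhds
          (by simpa using (show ‖x.2‖ ∈ X.radii from hx.1)))] with s hs using ⟨hs, rfl⟩
    · refine (h3.prodMk h1).congr_deriv (Prod.ext ?_ rfl)
      simp [h, dr]

theorem mem_nullLift_nullCone {σ c : ℝ} {p : Event n × Covector n} :
    p ∈ X.nullLift (X.nullCone σ c) ↔ p ∈ X.nullSection ∧ p.1 ∈ X.nullCone σ c ∧
      (X.sharp p.1 p.2).1 = σ * ((X.f ‖p.1.2‖)⁻¹ * dr p.1 (X.sharp p.1 p.2)) :=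
  and_congr_right fun _ => and_congr_right fun hp => mem_tangentVectors_nullCone hp

/-- The null lift of a principal null hypersurface in terms of linear equations in the fibres. -/
theorem mem_nullLift_nullCone_iff {σ c : ℝ} (hσ : σ ^ 2 = 1) {p : Event n × Covector n} :
    p ∈ X.nullLift (X.nullCone σ c) ↔ (p.1 ∈ X.carrier ∧ timePart n p.2 ≠ 0) ∧
      p.1.1 - (c + σ * X.tortoise ‖p.1.2‖) = 0 ∧
      spacePart n p.2 + (σ * timePart n p.2 / (X.f ‖p.1.2‖ * ‖p.1.2‖)) • p.1.2 = 0 := by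
  rw [mem_nullLift_nullCone]
  constructor
  · rintro ⟨hnull, hx, htan⟩
    have ha : timePart n p.2 ≠ 0 := fun h0 =>
      sharp_fst_ne_zero hnull (by rw [sharp_fst, h0, mul_zero])
    have hr := X.norm_pos hnull.1
    have hf := X.f_pos _ hnull.1
    refine ⟨⟨hnull.1, ha⟩, sub_eq_zero.2 hx.2, ?_⟩
    have h0 := hnull.2.2
    rw [metric_sharp_self hnull.1] at h0
    rw [dr_sharp hnull.1, sharp_fst] at htan
    have hyb : inner ℝ p.1.2 (spacePart n p.2) =
        -(σ * timePart n p.2 * ‖p.1.2‖ / X.f ‖p.1.2‖) := by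
      field_simp at htan ⊢
      linear_combination (-σ) * htan - X.f ‖p.1.2‖ * inner ℝ p.1.2 (spacePart n p.2) * hσ
    -- Tangency fixes the radial part of `b`, and nullity then leaves no room for an angular part:
    -- the squared norm of the difference is zero.
    rw [← norm_eq_zero, ← sq_eq_zero_iff, norm_add_sq_real, inner_smul_right, real_inner_comm,
      norm_smul, mul_pow, Real.norm_eq_abs, sq_abs]
    rw [hyb] at h0 ⊢
    have hbb : ‖spacePart n p.2‖ ^ 2 = timePart n p.2 ^ 2 / X.f ‖p.1.2‖ ^ 2 := by
      field_simp at h0 ⊢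
      linear_combination h0 - (X.f ‖p.1.2‖ - 1) * timePart n p.2 ^ 2 * hσ
    rw [hbb]
    field_simp
    linear_combination -timePart n p.2 ^ 2 * hσ
  · rintro ⟨⟨hc, ha⟩, ht, hb⟩
    have hr := X.norm_pos hc
    have hf := X.f_pos _ hc
    have hb' := eq_neg_of_add_eq_zero_left hb
    have hyb : inner ℝ p.1.2 (spacePart n p.2) =
        -(σ * timePart n p.2 * ‖p.1.2‖ / X.f ‖p.1.2‖) := by
      rw [hb', inner_neg_right, inner_smul_right, real_inner_self_eq_norm_sq]
      field_simp
    have hbb : ‖spacePart n p.2‖ ^ 2 = timePart n p.2 ^ 2 / X.f ‖p.1.2‖ ^ 2 := by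
      rw [hb', norm_neg, norm_smul, mul_pow, Real.norm_eq_abs, sq_abs]
      field_simp
      exact hσ
    refine ⟨⟨hc, fun h => ha (by rw [h, map_zero]), ?_⟩, ⟨hc, sub_eq_zero.1 ht⟩, ?_⟩
    · rw [metric_sharp_self hc, hbb, hyb]
      field_simp
      linear_combination timePart n p.2 ^ 2 * (X.f ‖p.1.2‖ - 1) * hσ
    · rw [dr_sharp hc, sharp_fst, hyb]
      field_simp
      linear_combination hσ

theorem nullLift_nullCone_nonempty (hn : 2 ≤ n) (hX : X.radii.Nonempty) {σ c : ℝ}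
    (hσ : σ ^ 2 = 1) : (X.nullLift (X.nullCone σ c)).Nonempty := by
  obtain ⟨r, hr⟩ := hX
  obtain ⟨e, he, -⟩ := exists_unit_orthogonal hn 0
  have hr0 : 0 < r := X.radii_pos hr
  have hre : ‖r • e‖ = r := by simp [norm_smul, he, hr0.le]
  refine ⟨((c + σ * X.tortoise r, r • e), covectorMk 1 (-((σ / (X.f r * r)) • r • e))),
    (mem_nullLift_nullCone_iff hσ).2 ⟨⟨?_, ?_⟩, ?_, ?_⟩⟩
  · simpa [carrier, hre] using hr
  · simp [timePart_covectorMk]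
  · simp [hre]
  · simp only [spacePart_covectorMk, timePart_covectorMk, hre, mul_one]
    exact neg_add_cancel _

/-- The equations are solved for `t` and `b`, so moving these two with `y` and `a` fixed realizes
every velocity of `φ`. -/
theorem isEmbeddedSubmanifold_nullLift_nullCone {σ c : ℝ} (hσ : σ ^ 2 = 1) :
    IsEmbeddedSubmanifold (n + 1) (X.nullLift (X.nullCone σ c)) := by
  refine isEmbeddedSubmanifold_of_eq (k := n + 1)
    (U := {p | p.1 ∈ X.carrier ∧ timePart n p.2 ≠ 0})
    (φ := fun p => Fin.cons (p.1.1 - (c + σ * X.tortoise ‖p.1.2‖)) fun i : Fin n =>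
      (spacePart n p.2 + (σ * timePart n p.2 / (X.f ‖p.1.2‖ * ‖p.1.2‖)) • p.1.2) i)
    (by rw [finrank_cotangent]; ring)
    ((X.isOpen_carrier.preimage continuous_fst).inter
      (isOpen_ne.preimage contDiff_timePart.continuous)) ?_ ?_ ?_
  · intro p hp
    refine ContDiffAt.contDiffWithinAt (contDiffAt_pi.2 fun i => ?_)
    have hr0 := (X.norm_pos hp.1).ne'
    have hf0 := (X.f_pos _ hp.1).ne'
    have hy := (contDiff_position (n := n)).contDiffAt (x := p)
    have ha := (contDiff_timePart (n := n)).contDiffAt (x := p)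
    have hb := (contDiff_spacePart (n := n)).contDiffAt (x := p)
    have hr : ContDiffAt ℝ ∞ (fun p : Event n × Covector n => ‖p.1.2‖) p :=
      hy.norm ℝ (X.snd_ne_zero hp.1)
    have hf : ContDiffAt ℝ ∞ (fun p : Event n × Covector n => X.f ‖p.1.2‖) p :=
      ContDiffAt.comp (g := X.f) p
        (X.contDiffOn_f.contDiffAt (X.isOpen_radii.mem_nhds hp.1)) hr
    refine Fin.cases ?_ (fun j => ?_) i
    · exact contDiff_time.contDiffAt.sub (contDiffAt_const.add (contDiffAt_const.mul
        (ContDiffAt.comp (g := X.tortoise) p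
          (contDiffOn_tortoise.contDiffAt (X.isOpen_radii.mem_nhds hp.1)) hr)))
    · exact (contDiffAt_euclidean.1 (hb.add (((contDiffAt_const.mul ha).div (hf.mul hr)
        (mul_ne_zero hf0 hr0)).smul hy))) j
  · rintro ⟨⟨t, y⟩, α⟩ - a
    have h1 := hasDerivAt_add_smul t (a 0)
    refine ⟨((a 0, 0), covectorMk 0 (WithLp.toLp 2 fun i => a i.succ)),
      hasDerivAt_pi.2 fun i => ?_⟩
    simp only [Prod.fst_add, Prod.snd_add, Prod.smul_fst, Prod.smul_snd, map_add, map_smul,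
      spacePart_covectorMk, timePart_covectorMk, smul_zero, add_zero]
    refine Fin.cases ?_ (fun j => ?_) i
    · exact h1.sub_const _
    · exact (hasDerivAt_add_smul (spacePart n α j) (a j.succ)).add_const _
  · ext p
    rw [mem_nullLift_nullCone_iff hσ]
    simp only [mem_ofPred, funext_iff, Fin.forall_fin_succ, Fin.cons_zero, Fin.cons_succ,
      Pi.zero_apply]
    refine and_congr_right fun _ => and_congr_right fun _ => ?_
    exact ⟨fun h i => by rw [h]; rfl, fun h => by ext i; exact h i⟩

theorem metric_rotationField {x v : Event n} (i j : Fin n) :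
    X.metric x (rotationField i j x) v = x.2 i * v.2 j - x.2 j * v.2 i := by
  have h : dr x (rotationField i j x) = 0 := by
    simp only [dr, rotationField, inner_sub_right, inner_smul_right,
      EuclideanSpace.inner_single_right]
    simp [mul_comm]
  rw [metric, h]
  simp only [rotationField, inner_sub_left, inner_smul_left, EuclideanSpace.inner_single_left]
  simp

/-- The products with the rotation fields are the `2 × 2` minors of `y` and the spatial velocity.
All vanish exactly when the velocity is parallel to `y`. -/
theorem angularMomentum_eq_zero_iff {x v : Event n} (hx : x.2 ≠ 0) :
    X.angularMomentum x v = 0 ↔ v.2 = (dr x v / ‖x.2‖) • x.2 := by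
  have hr : ‖x.2‖ ≠ 0 := norm_ne_zero_iff.2 hx
  have hnn : ∀ i j, 0 ≤ X.metric x (rotationField i j x) v ^ 2 := fun _ _ => sq_nonneg _
  have h1 : X.angularMomentum x v = 0 ↔ ∀ i j, x.2 i * v.2 j - x.2 j * v.2 i = 0 := by
    rw [angularMomentum, Real.sqrt_eq_zero (mul_nonneg (by norm_num)
      (Finset.sum_nonneg fun i _ => Finset.sum_nonneg fun j _ => hnn i j))]
    rw [mul_eq_zero, or_iff_right (by norm_num),
      Finset.sum_eq_zero_iff_of_nonneg fun i _ => Finset.sum_nonneg fun j _ => hnn i j]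
    simp only [Finset.mem_univ, forall_const]
    refine forall_congr' fun i => ?_
    rw [Finset.sum_eq_zero_iff_of_nonneg fun j _ => hnn i j]
    simp [metric_rotationField]
  rw [h1]
  constructor
  · intro h
    ext i
    have h2 : ‖x.2‖ ^ 2 * v.2 i = inner ℝ x.2 v.2 * x.2 i := by
      rw [← real_inner_self_eq_norm_sq, PiLp.inner_apply, PiLp.inner_apply, Finset.sum_mul,
        Finset.sum_mul]
      refine Finset.sum_congr rfl fun j _ => ?_
      simp only [RCLike.inner_apply, conj_trivial]
      linear_combination x.2 j * h j i
    simp only [dr, PiLp.smul_apply, smul_eq_mul]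
    field_simp
    linear_combination h2
  · intro h i j
    rw [h]
    simp only [PiLp.smul_apply, smul_eq_mul]
    ring

/-- The radial null geodesic with `r = r₀ + e s`. -/
noncomputable def ray (X : ClassS n) (σ c r₀ e : ℝ) (ξ : EuclideanSpace ℝ (Fin n)) (s : ℝ) :
    Event n :=
  (c + σ * X.tortoise (r₀ + s * e), (r₀ + s * e) • ξ)

/-- The parameters for which the radius `r₀ + e s` is admissible. -/
def rayDomain (X : ClassS n) (r₀ e : ℝ) : Set ℝ := {s | r₀ + s * e ∈ X.radii}

section Ray

variable {σ c r₀ e : ℝ} {ξ : EuclideanSpace ℝ (Fin n)}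

theorem isOpen_rayDomain : IsOpen (X.rayDomain r₀ e) :=
  X.isOpen_radii.preimage (by fun_prop)

theorem ordConnected_rayDomain : (X.rayDomain r₀ e).OrdConnected := by
  rcases le_total 0 e with he | he
  · exact X.ordConnected_radii.preimage_mono fun a b hab => by
      simpa using mul_le_mul_of_nonneg_right hab he
  · exact X.ordConnected_radii.preimage_anti fun a b hab => by
      simpa using mul_le_mul_of_nonpos_right hab he

theorem norm_ray (hξ : ‖ξ‖ = 1) {s : ℝ} (hs : s ∈ X.rayDomain r₀ e) :
    ‖(X.ray σ c r₀ e ξ s).2‖ = r₀ + s * e := by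
  have : 0 < r₀ + s * e := X.radii_pos hs
  rw [ray, norm_smul, hξ, mul_one, Real.norm_of_nonneg this.le]

theorem hasDerivAt_radius (r₀ e s : ℝ) : HasDerivAt (fun s => r₀ + s * e) e s := by
  simpa using ((hasDerivAt_id s).mul_const e).const_add r₀

theorem hasDerivAt_ray {s : ℝ} (hs : s ∈ X.rayDomain r₀ e) :
    HasDerivAt (X.ray σ c r₀ e ξ) (σ * ((X.f (r₀ + s * e))⁻¹ * e), e • ξ) s :=
  ((((hasDerivAt_tortoise hs).comp s (hasDerivAt_radius r₀ e s)).const_mul σ).const_add c).prodMk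
    ((hasDerivAt_radius r₀ e s).smul_const ξ)

theorem isNullGeodesic_ray (hσ : σ ^ 2 = 1) (he : e ≠ 0) (hξ : ‖ξ‖ = 1)
    (hne : (X.rayDomain r₀ e).Nonempty) :
    X.IsNullGeodesic (X.ray σ c r₀ e ξ) (X.rayDomain r₀ e) := by
  have hderiv : ∀ s ∈ X.rayDomain r₀ e, deriv (X.ray σ c r₀ e ξ) s =
      (σ * ((X.f (r₀ + s * e))⁻¹ * e), e • ξ) := fun s hs => (hasDerivAt_ray hs).deriv
  have hmaps : MapsTo (X.ray σ c r₀ e ξ) (X.rayDomain r₀ e) X.carrier := fun s hs => by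
    rw [carrier, mem_ofPred, norm_ray hξ hs]
    exact hs
  have hdr : ∀ s ∈ X.rayDomain r₀ e,
      inner ℝ (X.ray σ c r₀ e ξ s).2 (e • ξ) = (r₀ + s * e) * e := fun s hs => by
    rw [ray, inner_smul_left, inner_smul_right, real_inner_self_eq_norm_sq, hξ]
    simp
  have hee : inner ℝ (e • ξ) (e • ξ) = e ^ 2 := by
    rw [real_inner_self_eq_norm_sq, norm_smul, hξ, mul_one, Real.norm_eq_abs, sq_abs]
  refine ⟨isOpen_rayDomain, ordConnected_rayDomain, hne, hmaps, ?_, ?_, ?_, ?_⟩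
  · have h1 : ContDiff ℝ ∞ fun s : ℝ => r₀ + s * e := by fun_prop
    have h2 : ContDiffOn ℝ ∞ (fun s => X.tortoise (r₀ + s * e)) (X.rayDomain r₀ e) :=
      contDiffOn_tortoise.comp h1.contDiffOn fun s hs => hs
    exact ((contDiffOn_const.add (contDiffOn_const.mul h2)).prodMk
      (h1.contDiffOn.smul contDiffOn_const)).of_le ENat.LEInfty.out
  · intro s hs
    rw [hderiv s hs]
    intro h
    have h2 := congrArg (fun v : Event n => ‖v.2‖) h
    simp [norm_smul, hξ, he] at h2
  · intro s hs
    have hr0 : 0 < r₀ + s * e := X.radii_pos hs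
    have hf := X.f_pos _ hs
    rw [hderiv s hs, metric_eq, norm_ray hξ hs]
    simp only [hdr s hs, hee]
    field_simp
    linear_combination -e ^ 2 * hσ
  · intro s hs
    have hr0 : 0 < r₀ + s * e := X.radii_pos hs
    have hf := X.f_pos _ hs
    rw [X.geodesic_iff (hmaps hs), hderiv s hs]
    have h1 : HasDerivAt (fun s => (σ * ((X.f (r₀ + s * e))⁻¹ * e), e • ξ))
        (σ * (-(deriv X.f (r₀ + s * e) * e) / X.f (r₀ + s * e) ^ 2 * e), 0) s := by
      have h2 : HasDerivAt (fun s => X.f (r₀ + s * e)) (deriv X.f (r₀ + s * e) * e) s :=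
        HasDerivAt.comp (h₂ := X.f) s (X.hasDerivAt_f hs) (hasDerivAt_radius r₀ e s)
      exact (((h2.fun_inv hf.ne').mul_const e).const_mul σ).prodMk (hasDerivAt_const s (e • ξ))
    have h3 : deriv (deriv (X.ray σ c r₀ e ξ)) s = _ := (h1.congr_of_eventuallyEq
      ((show EqOn _ _ _ from hderiv).eventuallyEq_of_mem (isOpen_rayDomain.mem_nhds hs))).deriv
    rw [h3, accel]
    simp only [norm_ray hξ hs, hdr s hs, hee]
    refine Prod.ext ?_ ?_
    · simp only
      field_simp
    · simp only
      rw [eq_comm, smul_eq_zero]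
      left
      field_simp
      linear_combination -e ^ 2 * deriv X.f (r₀ + s * e) * (r₀ + s * e) * hσ

/-- In an extension, `r = r₀ + s e` persists at limit points of the domain, where `r` is still
admissible. The domain is thus open and relatively closed in the larger interval. -/
theorem isMaximalNullGeodesic_ray (hσ : σ ^ 2 = 1) (he : e ≠ 0) (hξ : ‖ξ‖ = 1)
    (hne : (X.rayDomain r₀ e).Nonempty) :
    X.IsMaximalNullGeodesic (X.ray σ c r₀ e ξ) (X.rayDomain r₀ e) := by
  refine ⟨isNullGeodesic_ray hσ he hξ hne, fun ζ J hζ hsub heq => ?_⟩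
  refine Subset.antisymm ?_ hsub
  obtain ⟨s₀, hs₀⟩ := hne
  refine hζ.ordConnected.isPreconnected.subset_of_closure_inter_subset isOpen_rayDomain
    ⟨s₀, hsub hs₀, hs₀⟩ ?_
  rintro s ⟨hsc, hsJ⟩
  have := mem_closure_iff_nhdsWithin_neBot.1 hsc
  have h1 : ‖(ζ s).2‖ = r₀ + s * e := by
    refine tendsto_nhds_unique_of_eventuallyEq
      ((hζ.hasDerivAt_norm hsJ).continuousAt.tendsto.mono_left nhdsWithin_le_nhds)
      ((hasDerivAt_radius r₀ e s).continuousAt.tendsto.mono_left nhdsWithin_le_nhds) ?_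
      (l := 𝓝[X.rayDomain r₀ e] s)
    filter_upwards [self_mem_nhdsWithin] with u hu
    rw [← heq hu, norm_ray hξ hu]
  rw [rayDomain, mem_ofPred, ← h1]
  exact hζ.mapsTo hsJ

theorem generated_ray (he : e ≠ 0) (hξ : ‖ξ‖ = 1) :
    generated (X.ray σ c r₀ e ξ) (X.rayDomain r₀ e) = X.nullCone σ c := by
  ext x
  constructor
  · rintro ⟨s, hs, h1, h2⟩
    rw [norm_ray hξ hs] at h2
    refine ⟨?_, ?_⟩
    · rw [carrier, mem_ofPred, h2]
      exact hs
    · rw [h1, h2, ray]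
  · rintro ⟨hx, h1⟩
    have h3 : r₀ + (‖x.2‖ - r₀) / e * e = ‖x.2‖ := by field_simp; ring
    have hs : (‖x.2‖ - r₀) / e ∈ X.rayDomain r₀ e := by
      rw [rayDomain, mem_ofPred, h3]
      exact hx
    refine ⟨_, hs, ?_, ?_⟩
    · rw [ray, h3, h1]
    · rw [norm_ray hξ hs, h3]

theorem isMaximalPrincipalNullHypersurface_nullCone (hn : 2 ≤ n) (hX : X.radii.Nonempty)
    (hσ : σ ^ 2 = 1) : X.IsMaximalPrincipalNullHypersurface (X.nullCone σ c) := by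
  obtain ⟨r, hr⟩ := hX
  obtain ⟨ξ, hξ, -⟩ := exists_unit_orthogonal hn 0
  have hne : (X.rayDomain r 1).Nonempty := ⟨0, by simpa [rayDomain] using hr⟩
  have hmax := isMaximalNullGeodesic_ray (c := c) hσ one_ne_zero hξ hne
  refine ⟨_, _, hmax, fun s hs => ?_, (generated_ray one_ne_zero hξ).symm⟩
  have hr0 : r + s * 1 ≠ 0 := (X.radii_pos hs).ne'
  rw [angularMomentum_eq_zero_iff (X.snd_ne_zero (hmax.1.mapsTo hs)), (hasDerivAt_ray hs).deriv,
    dr, norm_ray hξ hs, ray]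
  simp only [inner_smul_left, inner_smul_right, real_inner_self_eq_norm_sq, hξ, smul_smul]
  rw [mul_one] at hr0 ⊢
  congr 1
  simp only [conj_trivial]
  field_simp

end Ray

/-- A null geodesic of zero angular momentum is part of a radial one. -/
theorem IsNullGeodesic.exists_eqOn_ray {ζ : ℝ → Event n} {J : Set ℝ} (h : X.IsNullGeodesic ζ J)
    (h0 : ∀ s ∈ J, X.angularMomentum (ζ s) (deriv ζ s) = 0) :
    ∃ σ c r₀ e ξ, σ ^ 2 = 1 ∧ e ≠ 0 ∧ ‖ξ‖ = 1 ∧ J ⊆ X.rayDomain r₀ e ∧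
      EqOn ζ (X.ray σ c r₀ e ξ) J := by
  obtain ⟨s₀, hs₀⟩ := h.nonempty
  have hpre := h.ordConnected.isPreconnected
  have hconst : ∀ {E : Type} [NormedAddCommGroup E] [NormedSpace ℝ E] {g : ℝ → E},
      (∀ s ∈ J, HasDerivAt g 0 s) → ∀ s ∈ J, g s = g s₀ := fun {E} _ _ {g} hg s hs =>
    h.isOpen.is_const_of_deriv_eq_zero hpre
      (fun s hs => (hg s hs).differentiableAt.differentiableWithinAt)
      (fun s hs => (hg s hs).deriv) hs hs₀
  have hr0 : ∀ s ∈ J, ‖(ζ s).2‖ ≠ 0 := fun s hs => (X.norm_pos (h.mapsTo hs)).ne'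
  have hf0 : ∀ s ∈ J, X.f ‖(ζ s).2‖ ≠ 0 := fun s hs => (X.f_pos _ (h.mapsTo hs)).ne'
  have hw : ∀ s ∈ J, (deriv ζ s).2 = (dr (ζ s) (deriv ζ s) / ‖(ζ s).2‖) • (ζ s).2 := fun s hs =>
    (angularMomentum_eq_zero_iff (X.snd_ne_zero (h.mapsTo hs))).1 (h0 s hs)
  -- The energy `f dt/ds` is conserved because the metric is static.
  have hE := hconst (g := fun s => X.f ‖(ζ s).2‖ * (deriv ζ s).1) fun s hs => by
    have h1 : HasDerivAt (fun s => X.f ‖(ζ s).2‖) _ s :=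
      HasDerivAt.comp (h₂ := X.f) s (X.hasDerivAt_f (h.mapsTo hs)) (h.hasDerivAt_norm hs)
    refine (h1.fun_mul (hasDerivAt_fst_curve (h.hasDerivAt_deriv hs))).congr_deriv ?_
    have := hr0 s hs
    have := hf0 s hs
    simp only [accel, dr]
    field_simp
    ring
  set E := X.f ‖(ζ s₀).2‖ * (deriv ζ s₀).1 with hEdef
  have hE0 : E ≠ 0 := mul_ne_zero (hf0 s₀ hs₀) (h.fst_deriv_ne_zero hs₀)
  -- Without angular part, nullity reads `(dr/ds)² = E²`. Since `E ≠ 0` and the interval is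
  -- connected, `dr/ds` keeps one sign, hence is constant.
  have hsq : ∀ s ∈ J, dr (ζ s) (deriv ζ s) ^ 2 = E ^ 2 := by
    intro s hs
    have h1 := h.null s hs
    have h2 : ‖(deriv ζ s).2‖ ^ 2 = dr (ζ s) (deriv ζ s) ^ 2 := by
      rw [hw s hs, norm_smul, mul_pow, Real.norm_eq_abs, sq_abs]
      have := hr0 s hs
      field_simp
    rw [metric_self, h2] at h1
    rw [← hE s hs]
    have := hf0 s hs
    field_simp at h1
    linear_combination h1
  have hdrc : ContinuousOn (fun s => dr (ζ s) (deriv ζ s)) J := fun s hs =>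
    (((hasDerivAt_snd_curve (h.hasDerivAt hs)).continuousAt.inner
      (hasDerivAt_snd_curve (h.hasDerivAt_deriv hs)).continuousAt).div
      (h.hasDerivAt_norm hs).continuousAt (hr0 s hs)).continuousWithinAt
  obtain ⟨σ, hσ, hρ⟩ : ∃ σ : ℝ, σ ^ 2 = 1 ∧ ∀ s ∈ J, dr (ζ s) (deriv ζ s) = σ * E := by
    rcases hpre.eq_or_eq_neg_of_sq_eq hdrc (continuousOn_const (c := E))
      (fun s hs => hsq s hs) (fun _ => hE0) with h1 | h1
    · exact ⟨1, by norm_num, fun s hs => by rw [one_mul]; exact h1 hs⟩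
    · exact ⟨-1, by norm_num, fun s hs => by rw [neg_one_mul]; exact h1 hs⟩
  have hσ0 : σ ≠ 0 := by rintro rfl; norm_num at hσ
  have hrad := hconst (g := fun s => ‖(ζ s).2‖ - s * (σ * E)) fun s hs => by
    have h1 := (h.hasDerivAt_norm hs).sub ((hasDerivAt_id s).mul_const (σ * E))
    refine h1.congr_deriv ?_
    rw [hρ s hs]
    ring
  have htime := hconst (g := fun s => (ζ s).1 - σ * X.tortoise ‖(ζ s).2‖) fun s hs => by
    have h1 : HasDerivAt (fun s => X.tortoise ‖(ζ s).2‖) _ s :=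
      HasDerivAt.comp (h₂ := X.tortoise) s (hasDerivAt_tortoise (h.mapsTo hs))
        (h.hasDerivAt_norm hs)
    refine ((hasDerivAt_fst_curve (h.hasDerivAt hs)).sub (h1.const_mul σ)).congr_deriv ?_
    rw [hρ s hs, ← hE s hs]
    have := hf0 s hs
    field_simp
    linear_combination (-(deriv ζ s).1) * hσ
  have hdir := hconst (g := fun s => ‖(ζ s).2‖⁻¹ • (ζ s).2) fun s hs => by
    refine (((h.hasDerivAt_norm hs).fun_inv (hr0 s hs)).fun_smul
      (hasDerivAt_snd_curve (h.hasDerivAt hs))).congr_deriv ?_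
    rw [hw s hs, smul_smul, ← add_smul]
    have h1 := hr0 s hs
    rw [show ‖(ζ s).2‖⁻¹ * (dr (ζ s) (deriv ζ s) / ‖(ζ s).2‖) +
      -dr (ζ s) (deriv ζ s) / ‖(ζ s).2‖ ^ 2 = 0 by field_simp; ring, zero_smul]
  set r₀ := ‖(ζ s₀).2‖ - s₀ * (σ * E)
  have hrad' : ∀ s ∈ J, r₀ + s * (σ * E) = ‖(ζ s).2‖ := fun s hs => by
    linear_combination -hrad s hs
  refine ⟨σ, (ζ s₀).1 - σ * X.tortoise ‖(ζ s₀).2‖, r₀, σ * E, ‖(ζ s₀).2‖⁻¹ • (ζ s₀).2, hσ,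
    mul_ne_zero hσ0 hE0, norm_smul_inv_norm (X.snd_ne_zero (h.mapsTo hs₀)), fun s hs => ?_,
    fun s hs => ?_⟩
  · rw [rayDomain, mem_ofPred, hrad' s hs]
    exact h.mapsTo hs
  · rw [ray, hrad' s hs, ← hdir s hs, smul_smul, mul_inv_cancel₀ (hr0 s hs), one_smul,
      ← htime s hs]
    exact Prod.ext (by ring) rfl

/-- The geodesic is part of a full ray, so maximality makes it the whole ray. Its radius then sweeps
out all of `𝓘`, and rotations generate the whole cone. -/
theorem IsMaximalPrincipalNullHypersurface.exists_eq_nullCone {H : Set (Event n)}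
    (hH : X.IsMaximalPrincipalNullHypersurface H) :
    X.radii.Nonempty ∧ ∃ σ c, σ ^ 2 = 1 ∧ H = X.nullCone σ c := by
  obtain ⟨ζ, J, ⟨hζ, hmax⟩, h0, rfl⟩ := hH
  obtain ⟨s₀, hs₀⟩ := hζ.nonempty
  obtain ⟨σ, c, r₀, e, ξ, hσ, he, hξ, hJ, heq⟩ := hζ.exists_eqOn_ray h0
  have hray := isNullGeodesic_ray (c := c) hσ he hξ ⟨s₀, hJ hs₀⟩
  have hJeq := hmax _ _ hray hJ heq
  refine ⟨⟨_, hζ.mapsTo hs₀⟩, σ, c, hσ, ?_⟩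
  rw [← generated_ray (r₀ := r₀) he hξ, hJeq]
  ext x
  exact exists_congr fun s => and_congr_right fun hs => by rw [heq hs]

/-- The lifts of different null cones are disjoint. -/
theorem nullCone_eq_of_mem_nullLift {σ σ' c c' : ℝ}
    {p : Event n × Covector n} (hp : p ∈ X.nullLift (X.nullCone σ c))
    (hp' : p ∈ X.nullLift (X.nullCone σ' c')) : X.nullCone σ c = X.nullCone σ' c' := by
  have h1 := mem_nullLift_nullCone.1 hp
  have h2 := mem_nullLift_nullCone.1 hp'
  have h0 := sharp_fst_ne_zero h1.1
  have hne : (X.f ‖p.1.2‖)⁻¹ * dr p.1 (X.sharp p.1 p.2) ≠ 0 := by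
    intro h
    rw [h1.2.2, h, mul_zero] at h0
    exact h0 rfl
  -- The direction of the covector fixes the sign `σ`, and its base point then fixes `c`.
  obtain rfl : σ = σ' := mul_right_cancel₀ hne (h1.2.2.symm.trans h2.2.2)
  obtain rfl : c = c' := by linear_combination h2.2.1.2 - h1.2.1.2
  rfl

/-- The lifts of photon surfaces and of null cones are disjoint. -/
theorem IsProfile.notMem_nullLift_nullCone {T : Set ℝ} {R : ℝ → ℝ} (h : X.IsProfile T R)
    {σ c : ℝ} (hσ : σ ^ 2 = 1) {p : Event n × Covector n}
    (hp : p ∈ X.nullLift (profileGraph n T R)) : p ∉ X.nullLift (X.nullCone σ c) := by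
  intro hp'
  have h1 := h.mem_nullLift.1 hp
  have h2 := mem_nullLift_nullCone.1 hp'
  have hf := X.f_pos _ h1.1.1
  have hq := sq_lt_of_timelike (h.timelike _ h1.2.1.1)
  rw [← h1.2.1.2] at hq
  have h3 := h2.2.2
  rw [h1.2.2] at h3
  set v := (X.sharp p.1 p.2).1
  have hv : v ≠ 0 := sharp_fst_ne_zero h1.1
  have h4 : X.f ‖p.1.2‖ = σ * deriv R p.1.1 := by
    field_simp at h3
    exact h3
  rw [h4, mul_pow, hσ, one_mul] at hq
  exact lt_irrefl _ hq

/-- Nullity gives `|dr/dt| ≤ f`. Strict inequality provides admissible data for a maximal profile;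
equality gives tangency to the null cone through the point with the matching sign. -/
theorem exists_mem_nullLift (hn : 2 ≤ n) {p : Event n × Covector n} (hp : p ∈ X.nullSection) :
    (∃ P, X.IsMaximalSphericalPhotonSurface P ∧ p ∈ X.nullLift P) ∨
      ∃ H, X.IsMaximalPrincipalNullHypersurface H ∧ p ∈ X.nullLift H := by
  have hf := X.f_pos _ hp.1
  have hv := sharp_fst_ne_zero hp
  have hnull := hp.2.2
  have hle := dr_sq_le p.1 (X.sharp p.1 p.2)
  rw [metric_self] at hnull
  set v := X.sharp p.1 p.2 with hvdef
  have hle' : dr p.1 v ^ 2 ≤ (X.f ‖p.1.2‖ * v.1) ^ 2 := by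
    have h1 : (X.f ‖p.1.2‖)⁻¹ * dr p.1 v ^ 2 ≤ X.f ‖p.1.2‖ * v.1 ^ 2 := by linarith
    rw [inv_mul_le_iff₀ hf] at h1
    linarith
  rcases hle'.lt_or_eq with hlt | heq
  · left
    have hq : |dr p.1 v / v.1| < X.f ‖p.1.2‖ := by
      rw [abs_div, div_lt_iff₀ (abs_pos.2 hv)]
      have := sq_lt_sq.1 hlt
      rwa [abs_mul, abs_of_pos hf] at this
    obtain ⟨T, R, h, ht, hR, hR', hmax, -⟩ :=
      exists_isMaximalSphericalPhotonSurface (X := X) hn p.1.1 hp.1 hq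
    refine ⟨_, hmax, h.mem_nullLift.2 ⟨hp, ⟨ht, hR.symm⟩, ?_⟩⟩
    rw [hR', ← hvdef, div_mul_cancel₀ _ hv]
  · right
    obtain ⟨σ, hσ, h1⟩ : ∃ σ : ℝ, σ ^ 2 = 1 ∧ dr p.1 v = σ * (X.f ‖p.1.2‖ * v.1) := by
      rcases sq_eq_sq_iff_eq_or_eq_neg.1 heq with h | h
      · exact ⟨1, by norm_num, by rw [one_mul, h]⟩
      · exact ⟨-1, by norm_num, by rw [neg_one_mul, h]⟩
    refine ⟨X.nullCone σ (p.1.1 - σ * X.tortoise ‖p.1.2‖),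
      isMaximalPrincipalNullHypersurface_nullCone hn ⟨_, hp.1⟩ hσ,
      mem_nullLift_nullCone.2 ⟨hp, ⟨hp.1, by ring⟩, ?_⟩⟩
    rw [← hvdef, h1]
    field_simp
    exact hσ.symm

end ClassS

/-! ### The foliation of the null section -/

theorem proposition3p6 {n : ℕ} (hn : 2 ≤ n) (X : ClassS n) :
    (∀ P, X.IsMaximalSphericalPhotonSurface P →
      (X.nullLift P).Nonempty ∧ IsEmbeddedSubmanifold (2 * n - 1) (X.nullLift P)) ∧
    (∀ H, X.IsMaximalPrincipalNullHypersurface H →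
      (X.nullLift H).Nonempty ∧ IsEmbeddedSubmanifold (n + 1) (X.nullLift H)) ∧
    Disjoint {P | X.IsMaximalSphericalPhotonSurface P}
      {H | X.IsMaximalPrincipalNullHypersurface H} ∧
    ({P | X.IsMaximalSphericalPhotonSurface P} ∪
      {H | X.IsMaximalPrincipalNullHypersurface H}).PairwiseDisjoint X.nullLift ∧
    (⋃ P ∈ {P | X.IsMaximalSphericalPhotonSurface P}, X.nullLift P) ∪
      (⋃ H ∈ {H | X.IsMaximalPrincipalNullHypersurface H}, X.nullLift H) = X.nullSection := by
  have hP : ∀ P, X.IsMaximalSphericalPhotonSurface P →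
      (X.nullLift P).Nonempty ∧ IsEmbeddedSubmanifold (2 * n - 1) (X.nullLift P) := by
    intro P hP
    obtain ⟨T, R, h, hT, rfl⟩ := hP.1.exists_isProfile hn
    exact ⟨h.nullLift_nonempty hn hT, h.isEmbeddedSubmanifold_nullLift hn⟩
  have hPH : ∀ P H, X.IsMaximalSphericalPhotonSurface P →
      X.IsMaximalPrincipalNullHypersurface H → Disjoint (X.nullLift P) (X.nullLift H) := by
    intro P H hP hH
    obtain ⟨T, R, h, -, rfl⟩ := hP.1.exists_isProfile hn
    obtain ⟨-, σ, c, hσ, rfl⟩ := hH.exists_eq_nullCone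
    exact Set.disjoint_left.2 fun p hp => h.notMem_nullLift_nullCone hσ hp
  refine ⟨hP, ?_, ?_, ?_, ?_⟩
  · intro H hH
    obtain ⟨hX, σ, c, hσ, rfl⟩ := hH.exists_eq_nullCone
    exact ⟨ClassS.nullLift_nullCone_nonempty hn hX hσ,
      ClassS.isEmbeddedSubmanifold_nullLift_nullCone hσ⟩
  -- A surface of both kinds would have a lift disjoint from itself, hence empty, but lifts of
  -- photon surfaces are nonempty.
  · refine Set.disjoint_left.2 fun S hS hS' => ?_
    obtain ⟨p, hp⟩ := (hP S hS).1
    exact Set.disjoint_left.1 (hPH S S hS hS') hp hp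
  · rintro S (hS | hS) S' (hS' | hS') hne
    · exact Set.disjoint_left.2 fun p hp hp' => hne (hS.eq_of_mem_nullLift hn hS' hp hp')
    · exact hPH S S' hS hS'
    · exact (hPH S' S hS' hS).symm
    · obtain ⟨-, σ, c, hσ, rfl⟩ := hS.exists_eq_nullCone
      obtain ⟨-, σ', c', hσ', rfl⟩ := hS'.exists_eq_nullCone
      exact Set.disjoint_left.2 fun p hp hp' =>
        hne (ClassS.nullCone_eq_of_mem_nullLift hp hp')
  · ext p
    simp only [mem_union, mem_iUnion, exists_prop, mem_ofPred]
    constructor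
    · rintro (⟨S, -, hp⟩ | ⟨S, -, hp⟩) <;> exact hp.1
    · exact ClassS.exists_mem_nullLift hn
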